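/- Let $\mathbb D$ be the open unit disk. Let $\mathfrak p\in\mathbb C[z,w]$ be square free and inner toral (every zero $(z,w)$ of $\mathfrak p$ satisfies $|z|,|w|<1$, or $|z|=|w|=1$, or $|z|,|w|>1$), let $\mathfrak p=\mathfrak p_1\cdots\mathfrak p_s$ with irreducible $\mathfrak p_j$, and let $(n_j,m_j)$ be the bidegree of $\mathfrak p_j$, i.e. its degrees in $z$ and in $w$. Let $V=(S,T)$ be a pure $\mathfrak p$-isopair on a complex Hilbert space $\mathcal H$: $S$ and $T$ are commuting pure isometries (an isometry $W$ is pure if $\bigcap_n W^n\mathcal H=\{0\}$), $\mathfrak p(S,T)=0$, and $\mathfrak p$ divides every $q\in\mathbb C[z,w]$ with $q(S,T)=0$. Assume that its bimultiplicity $(M,N)=(\dim\ker S^*,\dim\ker T^*)$ is finite. Then there are positive integers $\alpha_1,\dots,\alpha_s$ such that: (i) $N=\sum_{j}\alpha_j n_j$ and $M=\sum_{j}\alpha_j m_j$. (ii) For each $j$ and each $(\lambda,\mu)\in\mathbb D^2$ with $\mathfrak p_j(\lambda,\mu)=0$ that is a regular point of $\mathfrak p$ (that is, $\nabla\mathfrak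 p(\lambda,\mu)\neq0$), $$\dim\bigl(\ker(S-\lambda)^*\cap\ker(T-\mu)^*\bigr)=\alpha_j.$$ (iii) There is an $M\times M$ matrix-valued rational inner function $\Phi$ (rational without poles in $\overline{\mathbb D}$, and unitary on the unit circle) such that $V$ is unitarily equivalent to the pair $(M_z,M_\Phi)$ of multiplication operators on the Hardy space $H^2_{\mathbb C^M}$. For every such $\Phi$ the following hold. (a) There is a polynomial $d\in\mathbb C[z]$ without zeros in $\overline{\mathbb D}$ such that, for all $z\in\overline{\mathbb D}$ and $w\in\mathbb C$, $$d(z)\,\det\bigl(wI-\Phi(z)\bigr)=\prod_{j=1}^s\mathfrak p_j(z,w)^{\alpha_j}.$$ (b) For each $\lambda\in\overline{\mathbb D}$ such that $\mathfrak p(\lambda,\cdot)$ has $\sum_j m_j$ distinct zeros, $\Phi(\lambda)$ is diagonalizable and similar to $$\bigoplus_{j=1}^s\ \bigoplus_{\mu:\ \mathfrak p_j(\lambda,\mu)=0}\mu I_{\alpha_j}.$$ -/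

import Mathlib

open scoped BigOperators

/-- The value `p(z,w)` of a polynomial in two variables; variable `0` is `z`, variable `1` is `w`. -/
noncomputable def polyVal (p : MvPolynomial (Fin 2) ℂ) (z w : ℂ) : ℂ :=
  MvPolynomial.eval ![z, w] p

/-- `p(S,T)`: replace each monomial `z ^ a * w ^ b` of `p` by the operator `S ^ a * T ^ b`. -/
noncomputable def polyOp {H : Type*} [NormedAddCommGroup H] [InnerProductSpace ℂ H]
    (p : MvPolynomial (Fin 2) ℂ) (S T : H →L[ℂ] H) : H →L[ℂ] H :=
  ∑ m ∈ p.support, p.coeff m • (S ^ (m 0) * T ^ (m 1))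

/-- Inner toral: the zero set is contained in `𝔻² ∪ 𝕋² ∪ 𝔼²`. -/
def IsInnerToral (p : MvPolynomial (Fin 2) ℂ) : Prop :=
  ∀ z w : ℂ, polyVal p z w = 0 →
    (‖z‖ < 1 ∧ ‖w‖ < 1) ∨ (‖z‖ = 1 ∧ ‖w‖ = 1) ∨ (1 < ‖z‖ ∧ 1 < ‖w‖)

/-- A regular point: a zero of `p` at which the gradient of `p` does not vanish. -/
def IsRegularPoint (p : MvPolynomial (Fin 2) ℂ) (z w : ℂ) : Prop :=
  polyVal p z w = 0 ∧
    (polyVal (MvPolynomial.pderiv 0 p) z w ≠ 0 ∨ polyVal (MvPolynomial.pderiv 1 p) z w ≠ 0)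

/-- A pure isometry: `⋂ Vⁿ(H) = 0`. -/
def IsPureIsometry {H : Type*} [NormedAddCommGroup H] [InnerProductSpace ℂ H]
    (V : H →L[ℂ] H) : Prop :=
  (∀ x, ‖V x‖ = ‖x‖) ∧ ∀ x, (∀ n : ℕ, ∃ y, (V ^ n) y = x) → x = 0

/-- The pair `(S,T)` is a pure `p`-isopair: a commuting pair of pure isometries for which `p` is
the minimal polynomial, i.e. `p(S,T) = 0` and `p` divides every `q` with `q(S,T) = 0`. -/
structure IsPureIsopair {H : Type*} [NormedAddCommGroup H] [InnerProductSpace ℂ H]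
    (p : MvPolynomial (Fin 2) ℂ) (S T : H →L[ℂ] H) : Prop where
  pure_left : IsPureIsometry S
  pure_right : IsPureIsometry T
  comm : S * T = T * S
  annihilates : polyOp p S T = 0
  minimal : ∀ q : MvPolynomial (Fin 2) ℂ, polyOp q S T = 0 → p ∣ q

/-- The isometry `V` has finite multiplicity `M`, i.e. `dim ker V* = M`. -/
def HasMultiplicity {H : Type*} [NormedAddCommGroup H] [InnerProductSpace ℂ H] [CompleteSpace H]
    (V : H →L[ℂ] H) (M : ℕ) : Prop :=
  FiniteDimensional ℂ (LinearMap.ker (ContinuousLinearMap.adjoint V).toLinearMap) ∧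
    Module.finrank ℂ (LinearMap.ker (ContinuousLinearMap.adjoint V).toLinearMap) = M

/-- The joint eigenspace `ker (S - a)* ∩ ker (T - b)*`. -/
noncomputable def jointKer {H : Type*} [NormedAddCommGroup H] [InnerProductSpace ℂ H]
    [CompleteSpace H] (S T : H →L[ℂ] H) (a b : ℂ) : Submodule ℂ H :=
  LinearMap.ker (ContinuousLinearMap.adjoint (S - a • (1 : H →L[ℂ] H))).toLinearMap ⊓
    LinearMap.ker (ContinuousLinearMap.adjoint (T - b • (1 : H →L[ℂ] H))).toLinearMap

/-- The Hardy space of `ℂ^M`-valued functions on the disk, as the space of square summable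
sequences of Taylor coefficients. -/
abbrev HardySpace (M : ℕ) : Type :=
  lp (fun _ : ℕ => EuclideanSpace ℂ (Fin M)) 2

/-- The value at `z` (with `‖z‖ < 1`) of an element of the Hardy space. -/
noncomputable def hardyVal {M : ℕ} (f : HardySpace M) (z : ℂ) : Fin M → ℂ :=
  fun i => ∑' n : ℕ, f n i * z ^ n

/-- Rational inner matrix functions: on the closed unit disk `Φ` is a matrix of polynomials over a
scalar polynomial without zeros there, and `Φ` is unitary on the unit circle. -/
def IsRationalInner {M : ℕ} (Φ : ℂ → Matrix (Fin M) (Fin M) ℂ) : Prop :=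
  (∃ (q : Polynomial ℂ) (P : Matrix (Fin M) (Fin M) (Polynomial ℂ)),
    ∀ z : ℂ, ‖z‖ ≤ 1 → q.eval z ≠ 0 ∧ q.eval z • Φ z = P.map (Polynomial.eval z)) ∧
  ∀ z : ℂ, ‖z‖ = 1 → Φ z ∈ Matrix.unitaryGroup (Fin M) ℂ

/-- `(S,T)` is modeled as `(M_z, M_Φ)`: a unitary from `H` onto the Hardy space turns `S` into
multiplication by `z` and `T` into multiplication by the rational inner function `Φ`. -/
def IsModel {H : Type*} [NormedAddCommGroup H] [InnerProductSpace ℂ H] {M : ℕ}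
    (S T : H →L[ℂ] H) (Φ : ℂ → Matrix (Fin M) (Fin M) ℂ) : Prop :=
  IsRationalInner Φ ∧ ∃ U : H ≃ₗᵢ[ℂ] HardySpace M, ∀ (x : H) (z : ℂ), ‖z‖ < 1 →
    hardyVal (U (S x)) z = z • hardyVal (U x) z ∧
    hardyVal (U (T x)) z = (Φ z).mulVec (hardyVal (U x) z)

/-!
The pure isometry `S` of multiplicity `M` is the shift on the Hardy space (`exists_wold`), and `T`,
which commutes with it, is multiplication by a matrix function `Φ`. As `ker T*` is finite-dimensional
and invariant under `S*`, `Φ` is the transfer function of a unitary colligation with state space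
`ker T*`, hence rational inner (`exists_isModel`).

For any rational inner symbol `Φ = P / q`, evaluation at `z` gives `p(z, Φ(z)) = 0`, so the zeros of
`Q = det (q w - P)` over the disk are zeros of `p`. Therefore `Q` is a product of powers
`p_j ^ α_j` and a polynomial in `z` alone (`exists_factorization`). By Cayley–Hamilton `Q`
annihilates the pair, so minimality of `p` makes every `α_j` positive. Specializing to a fixed `z`
and comparing degrees and leading coefficients in `w` yields `M = ∑ α_j m_j` and the determinant
formula. Where `p(z, ·)` has simple roots, `Φ(z)` is diagonalizable with multiplicities `α_j`. The
joint eigenspace at `(a, b)` is the image under the Szegő kernel of `ker (Φ(a) - b)ᴴ`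
(`jointKer_eq_map`), so its dimension is `α_j` at every zero of `p_j` in the bidisk at which
`∂p/∂w ≠ 0`. All this is `exists_exponents`.

Applying the same to the pair `(T, S)` gives exponents `β_j` with `N = ∑ β_j n_j`, which are the
dimensions of the joint eigenspaces where `∂p/∂z ≠ 0`. Each component has a point in the bidisk at
which both derivatives are nonzero (`exists_generic_point`), so `β_j = α_j`; likewise the exponents
do not depend on the symbol.
-/

open Polynomial
open scoped Polynomial.Bivariate

/-! ### Plane curves over the disk -/

/-- By Gauss's lemma `F` stays irreducible over `ℂ(X)`, so `F` and `G` satisfy a Bézout identity there;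
clearing denominators puts a nonzero polynomial in `X` alone into the ideal `(F, G)`. -/
theorem finite_common_zeros {F G : ℂ[X][Y]} (hF : Irreducible F) (hd : 0 < F.natDegree)
    (hG : ¬ F ∣ G) :
    {z : ℂ | ∃ w : ℂ, F.evalEval z w = 0 ∧ G.evalEval z w = 0}.Finite := by
  have hprim : F.IsPrimitive := hF.isPrimitive hd.ne'
  have hirr := (hprim.irreducible_iff_irreducible_map_fraction_map (K := FractionRing ℂ[X])).1 hF
  have hnd : ¬ F.map (algebraMap ℂ[X] (FractionRing ℂ[X])) ∣ G.map (algebraMap _ _) :=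
    fun h => hG ((hprim.dvd_iff_fraction_map_dvd_fraction_map (K := FractionRing ℂ[X])).2 h)
  obtain ⟨u, v, huv⟩ := (hirr.coprime_iff_not_dvd).2 hnd
  obtain ⟨b, hb0, hb⟩ := IsLocalization.integerNormalization_spec (nonZeroDivisors ℂ[X]) u
  obtain ⟨c, hc0, hc⟩ := IsLocalization.integerNormalization_spec (nonZeroDivisors ℂ[X]) v
  set U := IsLocalization.integerNormalization (nonZeroDivisors ℂ[X]) u
  set V := IsLocalization.integerNormalization (nonZeroDivisors ℂ[X]) v
  have key : C c * U * F + C b * V * G = C (b * c) := by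
    apply Polynomial.map_injective _ (IsFractionRing.injective ℂ[X] (FractionRing ℂ[X]))
    simp only [Polynomial.map_add, Polynomial.map_mul, hb, hc, Polynomial.map_C, map_mul]
    simp only [Algebra.smul_def, ← Polynomial.algebraMap_eq] at *
    have e : ∀ r : ℂ[X], (algebraMap ℂ[X] (FractionRing ℂ[X])[X]) r =
      C ((algebraMap ℂ[X] (FractionRing ℂ[X])) r) := fun r => rfl
    simp only [e, Polynomial.algebraMap_eq]
    linear_combination (C ((algebraMap ℂ[X] (FractionRing ℂ[X])) b) *
      C ((algebraMap ℂ[X] (FractionRing ℂ[X])) c)) * huv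
  have hbc : b * c ≠ 0 :=
    mul_ne_zero (nonZeroDivisors.ne_zero hb0) (nonZeroDivisors.ne_zero hc0)
  refine (Polynomial.finite_setOfPred_isRoot hbc).subset ?_
  rintro z ⟨w, h1, h2⟩
  have := congrArg (evalEval z w) key
  simp only [evalEval_add, evalEval_mul, h1, h2, mul_zero, add_zero, evalEval_C] at this
  simpa [Polynomial.IsRoot] using this.symm

theorem infinite_disk_diff {s : Set ℂ} (hs : s.Finite) : ({z : ℂ | ‖z‖ < 1} \ s).Infinite := by
  refine Set.Infinite.sdiff ?_ hs
  have : {z : ℂ | ‖z‖ < 1} = Metric.ball 0 1 := by ext; simp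
  rw [this]
  exact infinite_of_mem_nhds (0 : ℂ) (Metric.ball_mem_nhds _ one_pos)

theorem exists_zero_of_leadingCoeff {F : ℂ[X][Y]} (hd : 0 < F.natDegree) {z : ℂ}
    (hz : F.leadingCoeff.eval z ≠ 0) : ∃ w, F.evalEval z w = 0 := by
  have h1 : (F.map (evalRingHom z)).natDegree = F.natDegree :=
    Polynomial.natDegree_map_of_leadingCoeff_ne_zero _ hz
  obtain ⟨w, hw⟩ := IsAlgClosed.exists_root (F.map (evalRingHom z)) (by
    intro h
    rw [Polynomial.degree_eq_natDegree (by rintro h0; rw [h0] at h1; simp at h1; omega), h1] at h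
    exact hd.ne' (by exact_mod_cast h))
  exact ⟨w, by rwa [IsRoot, map_evalRingHom_eval] at hw⟩

/-- A component of the zero set that is not vertical has a zero over the open unit disk which avoids
any prescribed curve not containing the component. -/
theorem exists_zero_avoiding {F G : ℂ[X][Y]} (hF : Irreducible F) (hd : 0 < F.natDegree)
    (hG : ¬ F ∣ G) : ∃ z w : ℂ, ‖z‖ < 1 ∧ F.evalEval z w = 0 ∧ G.evalEval z w ≠ 0 := by
  have hl : F.leadingCoeff ≠ 0 := leadingCoeff_ne_zero.2 hF.ne_zero
  obtain ⟨z, hz, hn⟩ := (infinite_disk_diff ((finite_common_zeros hF hd hG).union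
    (Polynomial.finite_setOfPred_isRoot hl))).nonempty
  simp only [Set.mem_union, Set.mem_ofPred_eq, not_or, not_exists, not_and] at hn
  obtain ⟨w, hw⟩ := exists_zero_of_leadingCoeff hd hn.2
  exact ⟨z, w, hz, hw, hn.1 w hw⟩

/-- If every zero of `Q` over the open unit disk is a zero of `∏ j, F j`, then `Q` is, up to a factor
in `X` alone, a product of powers of the `F j`: a further irreducible factor of positive degree in
`Y` would share infinitely many zeros with `∏ j, F j`, hence divide it. -/
theorem exists_factorization {s : ℕ} {F : Fin s → ℂ[X][Y]} (hirr : ∀ j, Irreducible (F j))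
    {Q : ℂ[X][Y]} (hQ : Q ≠ 0)
    (hz : ∀ z w : ℂ, ‖z‖ < 1 → Q.evalEval z w = 0 → (∏ j, F j).evalEval z w = 0) :
    ∃ (h : ℂ[X]) (α : Fin s → ℕ), Q = C h * ∏ j, F j ^ α j := by
  induction Q using WfDvdMonoid.induction_on_irreducible with
  | zero => exact absurd rfl hQ
  | unit u hu =>
    obtain ⟨c, hc, rfl⟩ := Polynomial.isUnit_iff.1 hu
    exact ⟨c, 0, by simp⟩
  | mul a i ha hi ih =>
    obtain ⟨h, α, rfl⟩ := ih ha fun z w hn h0 => hz z w hn (by simp [evalEval_mul, h0])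
    rcases Nat.eq_zero_or_pos i.natDegree with hi0 | hi0
    · obtain ⟨c, rfl⟩ := Polynomial.natDegree_eq_zero.1 hi0
      exact ⟨c * h, α, by rw [C_mul, mul_assoc]⟩
    · have hdvd : i ∣ ∏ j, F j := by
        by_contra hn
        obtain ⟨z, w, h1, h2, h3⟩ := exists_zero_avoiding hi hi0 hn
        exact h3 (hz z w h1 (by simp [evalEval_mul, h2]))
      obtain ⟨j, -, hj⟩ := (hi.prime.dvd_finsetProd_iff _).1 hdvd
      obtain ⟨u, hu⟩ := (hi.associated_of_dvd (hirr j) hj).symm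
      obtain ⟨c, hc, hcu⟩ := Polynomial.isUnit_iff.1 u.isUnit
      refine ⟨c * h, α + Pi.single j 1, ?_⟩
      rw [← hu, ← hcu]
      simp only [Pi.add_apply, pow_add, Finset.prod_mul_distrib]
      have : ∏ k, F k ^ (Pi.single j 1 : Fin s → ℕ) k = F j := by
        rw [Finset.prod_eq_single j] <;> simp +contextual
      rw [this, C_mul]; ring

/-- Squarefreeness makes the roots in `Y` generically simple along each component. -/
theorem not_dvd_derivative_prod {s : ℕ} {F : Fin s → ℂ[X][Y]} (hirr : ∀ j, Irreducible (F j))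
    (hsq : Squarefree (∏ j, F j)) {j : Fin s} (hd : 0 < (F j).natDegree) :
    ¬ F j ∣ derivative (∏ i, F i) := by
  classical
  intro h
  rw [← Finset.mul_prod_erase _ _ (Finset.mem_univ j), derivative_mul] at h
  rw [dvd_add_left (dvd_mul_right _ _)] at h
  rcases (hirr j).prime.dvd_or_dvd h with h | h
  · have h0 : derivative (F j) ≠ 0 := by
      intro h0; have := Polynomial.derivative_eq_zero.1 h0; omega
    have := Polynomial.natDegree_le_of_dvd h h0
    have := Polynomial.natDegree_derivative_lt hd.ne'
    omega
  · obtain ⟨i, hi, hij⟩ := ((hirr j).prime.dvd_finsetProd_iff _).1 h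
    refine (hirr j).not_isUnit (hsq (F j) ?_)
    rw [← Finset.mul_prod_erase _ _ (Finset.mem_univ j)]
    exact mul_dvd_mul_left _ (hij.trans (Finset.dvd_prod_of_mem _ hi))

theorem exponent_pos {s : ℕ} {F : Fin s → ℂ[X][Y]} (hirr : ∀ j, Irreducible (F j))
    (hsq : Squarefree (∏ j, F j)) {j : Fin s} (hd : 0 < (F j).natDegree)
    {h : ℂ[X]} (hh : h ≠ 0) {α : Fin s → ℕ} (hdvd : ∏ i, F i ∣ C h * ∏ i, F i ^ α i) :
    0 < α j := by
  classical
  by_contra hα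
  have hj := (Finset.dvd_prod_of_mem F (Finset.mem_univ j)).trans hdvd
  rcases (hirr j).prime.dvd_or_dvd hj with hj | hj
  · have := Polynomial.natDegree_le_of_dvd hj (by simpa using hh)
    simp at this; omega
  · obtain ⟨i, -, hi⟩ := ((hirr j).prime.dvd_finsetProd_iff _).1 hj
    have hij : i ≠ j := by
      rintro rfl
      rw [Nat.eq_zero_of_not_pos hα, pow_zero] at hi
      exact (hirr i).not_isUnit (isUnit_of_dvd_one hi)
    refine (hirr j).not_isUnit (hsq (F j) ?_)
    rw [← Finset.mul_prod_erase _ _ (Finset.mem_univ j)]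
    exact mul_dvd_mul_left _ (((hirr j).prime.dvd_of_dvd_pow hi).trans
      (Finset.dvd_prod_of_mem _ (by simp [hij])))

/-! ### Diagonalization at simple roots -/

/-- If `p = (X - b) g` annihilates `f` and `g b ≠ 0`, then `g` is coprime to every power of `X - b`,
so `g(f)` is injective on the generalized eigenspace and `f - b` vanishes there. -/
theorem maxGenEigenspace_eq_eigenspace_of_simple_root {K V : Type*} [Field K] [AddCommGroup V]
    [Module K V] {f : Module.End K V} {p : K[X]} (hp : aeval f p = 0) {b : K}
    (hb : p.eval b = 0) (hd : (derivative p).eval b ≠ 0) :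
    f.maxGenEigenspace b = f.eigenspace b := by
  refine le_antisymm (fun v hv => ?_) (Module.End.eigenspace_le_maxGenEigenspace)
  obtain ⟨k, hk⟩ := (Module.End.mem_maxGenEigenspace f b v).1 hv
  obtain ⟨g, rfl⟩ := Polynomial.dvd_iff_isRoot.2 hb
  have hg : g.eval b ≠ 0 := by simpa using hd
  have hcop : IsCoprime ((X - C b) ^ k) g := by
    refine IsCoprime.pow_left ?_
    rw [(Polynomial.irreducible_X_sub_C b).coprime_iff_not_dvd, Polynomial.dvd_iff_isRoot]
    exact hg
  obtain ⟨r, t, hrt⟩ := hcop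
  have e : aeval f (X - C b) = f - b • 1 := by
    simp [Algebra.smul_def]
  have h1 : (X - C b : K[X]) = r * ((X - C b) * (X - C b) ^ k) + t * ((X - C b) * g) := by
    linear_combination (-(X - C b)) * hrt
  have h2 := congrArg (fun q => aeval f q v) h1
  rw [Module.End.mem_eigenspace_iff]
  simp only [map_add, map_mul (aeval f) r, map_mul (aeval f) t, hp, map_mul (aeval f) (X - C b),
    map_pow, e] at h2
  simp only [mul_zero, Module.End.mul_apply, hk, map_zero, add_zero] at h2
  simpa [sub_eq_zero] using h2

theorem finrank_eigenspace_of_simple_root {K V : Type*} [Field K] [AddCommGroup V]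
    [Module K V] [FiniteDimensional K V] {f : Module.End K V} {p : K[X]} (hp : aeval f p = 0)
    {b : K} (hb : p.eval b = 0) (hd : (derivative p).eval b ≠ 0) :
    Module.finrank K (f.eigenspace b) = f.charpoly.rootMultiplicity b := by
  rw [← maxGenEigenspace_eq_eigenspace_of_simple_root hp hb hd,
    LinearMap.finrank_maxGenEigenspace_eq]

/-- A basis of eigenvectors sorted by a family `μ` of distinct eigenvalues. -/
theorem exists_basis_of_eigenspaces {K V ι : Type*} [Field K] [AddCommGroup V]
    [Module K V] [FiniteDimensional K V] (f : Module.End K V) {μ : ι → K}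
    (hμ : Function.Injective μ) {n : ι → ℕ}
    (hn : ∀ i, Module.finrank K (f.eigenspace (μ i)) = n i)
    (htop : ⨆ i, f.eigenspace (μ i) = ⊤) :
    ∃ b : Module.Basis (Σ i, Fin (n i)) K V, ∀ k, f (b k) = μ k.1 • b k := by
  classical
  have hint : DirectSum.IsInternal fun i => f.eigenspace (μ i) :=
    DirectSum.isInternal_submodule_of_iSupIndep_of_iSup_eq_top
      ((Module.End.eigenspaces_iSupIndep f).comp hμ) htop
  refine ⟨hint.collectedBasis fun i => Module.finBasisOfFinrankEq K _ (hn i), fun k => ?_⟩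
  exact Module.End.mem_eigenspace_iff.1 (hint.collectedBasis_mem _ k)

theorem iSup_eigenspace_eq_top_of_separable {V ι : Type*} [AddCommGroup V]
    [Module ℂ V] [FiniteDimensional ℂ V] {f : Module.End ℂ V} {p : ℂ[X]} (hp : aeval f p = 0)
    (hs : p.Separable) {μ : ι → ℂ} (hμ : ∀ w, p.eval w = 0 → ∃ i, μ i = w) :
    ⨆ i, f.eigenspace (μ i) = ⊤ := by
  rw [eq_top_iff, ← Module.End.iSup_maxGenEigenspace_eq_top f, iSup_le_iff]
  intro w
  by_cases hw : p.eval w = 0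
  · obtain ⟨i, rfl⟩ := hμ w hw
    rw [maxGenEigenspace_eq_eigenspace_of_simple_root hp hw
      (hs.aeval_derivative_ne_zero hw)]
    exact le_iSup (fun i => f.eigenspace (μ i)) i
  · have : ¬ f.HasEigenvalue w := fun h => by
      obtain ⟨v, hv⟩ := h.exists_hasEigenvector
      have := Module.End.aeval_apply_of_hasEigenvector (p := p) hv
      rw [hp, LinearMap.zero_apply] at this
      exact (smul_ne_zero hw hv.2) this.symm
    have h0 : f.maxGenEigenspace w = ⊥ := by
      by_contra hne
      apply this
      rw [Submodule.eq_bot_iff] at hne; push Not at hne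
      obtain ⟨v, hv, hv0⟩ := hne
      obtain ⟨k, hk⟩ := (Module.End.mem_maxGenEigenspace f w v).1 hv
      exact Module.End.hasEigenvalue_of_hasGenEigenvalue (k := k) (by
        rw [Module.End.hasGenEigenvalue_iff, Submodule.ne_bot_iff]
        exact ⟨v, by rw [Module.End.mem_genEigenspace_nat]; exact hk, hv0⟩)
    rw [h0]; exact bot_le

/-- A basis of eigenvectors as a similarity with a diagonal matrix, the indexing being chosen by the
basis. -/
theorem exists_diagonalization {M : ℕ} {κ : Type*} {A : Matrix (Fin M) (Fin M) ℂ} {μ : κ → ℂ}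
    (b : Module.Basis κ ℂ (Fin M → ℂ)) (hb : ∀ k, A.mulVec (b k) = μ k • b k) :
    ∃ (e : Fin M ≃ κ) (X : (Matrix (Fin M) (Fin M) ℂ)ˣ),
      A = (X : Matrix (Fin M) (Fin M) ℂ) * Matrix.diagonal (fun i => μ (e i)) *
        ((X⁻¹ : (Matrix (Fin M) (Fin M) ℂ)ˣ) : Matrix (Fin M) (Fin M) ℂ) := by
  let e := (Pi.basisFun ℂ (Fin M)).indexEquiv b
  let b' := b.reindex e.symm
  refine ⟨e, ⟨(Pi.basisFun ℂ (Fin M)).toMatrix b', b'.toMatrix (Pi.basisFun ℂ (Fin M)),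
    Module.Basis.toMatrix_mul_toMatrix_flip _ _, Module.Basis.toMatrix_mul_toMatrix_flip _ _⟩, ?_⟩
  rw [Units.eq_mul_inv_iff_mul_eq]
  ext i k
  rw [Matrix.mul_diagonal]
  have h := congrFun (hb (e k)) i
  simp only [Matrix.mulVec, dotProduct, Pi.smul_apply, smul_eq_mul] at h
  simp only [Matrix.mul_apply, Module.Basis.toMatrix_apply, Pi.basisFun_repr, b',
    Module.Basis.reindex_apply, Equiv.symm_symm]
  rw [h, mul_comm]

/-! ### The Hardy space and pointwise evaluation -/

/-- The Szegő kernel at a point `a` of the disk, as a linear map in its direction vector `v`: the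
element of the Hardy space with Taylor coefficients `conj a ^ n • v`. -/
noncomputable def szegoKernel {M : ℕ} {a : ℂ} (ha : ‖a‖ < 1) : (Fin M → ℂ) →ₗ[ℂ] HardySpace M where
  toFun v := ⟨fun n => (starRingEnd ℂ a) ^ n • WithLp.toLp 2 v, by
    refine memℓp_gen ?_
    have h : Summable fun n : ℕ => (‖a‖ ^ 2) ^ n :=
      summable_geometric_of_lt_one (by positivity) (by nlinarith [norm_nonneg a])
    refine (h.mul_right (‖WithLp.toLp 2 v‖ ^ 2)).congr fun n => ?_
    simp only [norm_smul, norm_pow, RCLike.norm_conj, ENNReal.toReal_ofNat, Real.rpow_ofNat]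
    ring⟩
  map_add' v w := by ext n : 2; exact smul_add _ _ _
  map_smul' c v := by ext n : 2; simp [smul_comm c]

theorem szegoKernel_coeff {M : ℕ} {a : ℂ} (ha : ‖a‖ < 1) (v : Fin M → ℂ) (n : ℕ) :
    szegoKernel ha v n = (starRingEnd ℂ a) ^ n • WithLp.toLp 2 v := rfl

theorem hasSum_hardyVal {M : ℕ} (f : HardySpace M) {z : ℂ} (hz : ‖z‖ < 1) (i : Fin M) :
    HasSum (fun n : ℕ => f n i * z ^ n) (hardyVal f z i) := by
  have h := lp.hasSum_inner (𝕜 := ℂ) (szegoKernel hz (Pi.single i 1)) f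
  refine Summable.hasSum (h.summable.congr fun n => ?_)
  have : WithLp.toLp 2 (Pi.single i 1 : Fin M → ℂ) = EuclideanSpace.single i 1 := rfl
  rw [szegoKernel_coeff, inner_smul_left, this, EuclideanSpace.inner_single_left]
  simp [mul_comm]

/-- The reproducing property of the Szegő kernel. -/
theorem inner_szegoKernel {M : ℕ} {a : ℂ} (ha : ‖a‖ < 1) (v : Fin M → ℂ) (f : HardySpace M) :
    inner ℂ (szegoKernel ha v) f = star v ⬝ᵥ hardyVal f a := by
  have h := lp.hasSum_inner (𝕜 := ℂ) (szegoKernel ha v) f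
  refine h.unique ?_
  have h2 := hasSum_sum fun i (_ : i ∈ Finset.univ) => (hasSum_hardyVal f ha i).mul_left (star v i)
  convert! h2 using 1
  ext n
  rw [szegoKernel_coeff, inner_smul_left, PiLp.inner_apply, Finset.mul_sum]
  refine Finset.sum_congr rfl fun i _ => ?_
  simp [RCLike.inner_apply]
  ring

/-- Evaluation at a point of the disk, as a bounded operator on the Hardy space. -/
noncomputable def hardyEval {M : ℕ} {z : ℂ} (hz : ‖z‖ < 1) : HardySpace M →L[ℂ] (Fin M → ℂ) :=
  ContinuousLinearMap.pi fun i => innerSL ℂ (szegoKernel hz (Pi.single i 1))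

theorem hardyEval_apply {M : ℕ} {z : ℂ} (hz : ‖z‖ < 1) (f : HardySpace M) :
    hardyEval hz f = hardyVal f z := by
  ext i
  simp only [hardyEval, ContinuousLinearMap.pi_apply, innerSL_apply_apply, inner_szegoKernel]
  rw [← Pi.single_star, star_one, single_one_dotProduct]

theorem hardyVal_add {M : ℕ} (f g : HardySpace M) {z : ℂ} (hz : ‖z‖ < 1) :
    hardyVal (f + g) z = hardyVal f z + hardyVal g z := by
  simp only [← hardyEval_apply hz, map_add]

theorem hardyVal_smul {M : ℕ} (c : ℂ) (f : HardySpace M) {z : ℂ} (hz : ‖z‖ < 1) :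
    hardyVal (c • f) z = c • hardyVal f z := by
  simp only [← hardyEval_apply hz, map_smul]

theorem hardyVal_sub {M : ℕ} (f g : HardySpace M) {z : ℂ} (hz : ‖z‖ < 1) :
    hardyVal (f - g) z = hardyVal f z - hardyVal g z := by
  simp only [← hardyEval_apply hz, map_sub]

theorem hardyVal_single {M : ℕ} (n : ℕ) (v : EuclideanSpace ℂ (Fin M)) (z : ℂ) :
    hardyVal (lp.single 2 n v : HardySpace M) z = z ^ n • (v : Fin M → ℂ) := by
  ext i
  rw [hardyVal, tsum_eq_single n]
  · simp [mul_comm]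
  · intro m hm
    simp [lp.single_apply, hm]

/-- The identity theorem for power series. -/
theorem eq_zero_of_hardyVal_eq_zero {M : ℕ} {f : HardySpace M}
    (hf : ∀ z : ℂ, ‖z‖ < 1 → hardyVal f z = 0) : f = 0 := by
  ext n i
  let p : FormalMultilinearSeries ℂ ℂ ℂ := FormalMultilinearSeries.ofScalars ℂ fun n => f n i
  have hr : 0 < p.radius := by
    refine lt_of_lt_of_le (b := ((1 / 2 : NNReal) : ENNReal)) (by simp) ?_
    refine p.le_radius_of_summable_norm ?_
    have h := (hasSum_hardyVal f (z := 1 / 2) (by norm_num) i).summable.norm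
    refine h.congr fun n => ?_
    simp [p]
  have h0 : HasFPowerSeriesAt (0 : ℂ → ℂ) p 0 := by
    refine (p.hasFPowerSeriesOnBall hr).hasFPowerSeriesAt.congr ?_
    filter_upwards [Metric.ball_mem_nhds (0 : ℂ) one_pos] with z hz
    have h1 : ‖z‖ < 1 := by simpa using hz
    have h2 := congrFun (hf z h1) i
    rw [Pi.zero_apply] at h2 ⊢
    rw [← h2, hardyVal, FormalMultilinearSeries.sum]
    simp [p, mul_comm]
  have h3 := congrFun h0.eq_zero n
  have h4 := congrArg (fun m => m fun _ => (1 : ℂ)) h3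
  simpa [p, FormalMultilinearSeries.ofScalars_apply_eq] using h4

theorem hardyVal_injective {M : ℕ} {f g : HardySpace M}
    (h : ∀ z : ℂ, ‖z‖ < 1 → hardyVal f z = hardyVal g z) : f = g :=
  sub_eq_zero.1 <| eq_zero_of_hardyVal_eq_zero fun z hz => by
    rw [hardyVal_sub f g hz, h z hz, sub_self]

section Model

variable {H : Type*} [NormedAddCommGroup H] [InnerProductSpace ℂ H]

/-- The value `F(S,T)` of a polynomial in `ℂ[X][Y]`, with `X` replaced by `S` and `Y` by `T`. -/
noncomputable def bivariateOp (F : ℂ[X][Y]) (S T : H →L[ℂ] H) : H →L[ℂ] H :=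
  F.eval₂ (aeval S : ℂ[X] →ₐ[ℂ] (H →L[ℂ] H)).toRingHom T

/-- The value `F(z,A)` of a polynomial in `ℂ[X][Y]` at a number and a matrix. -/
noncomputable def matrixVal {M : ℕ} (F : ℂ[X][Y]) (z : ℂ) (A : Matrix (Fin M) (Fin M) ℂ) :
    Matrix (Fin M) (Fin M) ℂ :=
  aeval A (F.map (evalRingHom z))

variable {M : ℕ} {S T : H →L[ℂ] H} {Φ : ℂ → Matrix (Fin M) (Fin M) ℂ}
  {U : H ≃ₗᵢ[ℂ] HardySpace M}

theorem hardyVal_aeval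
    (hS : ∀ (x : H) (z : ℂ), ‖z‖ < 1 → hardyVal (U (S x)) z = z • hardyVal (U x) z)
    (c : ℂ[X]) (x : H) {z : ℂ} (hz : ‖z‖ < 1) :
    hardyVal (U (aeval S c x)) z = c.eval z • hardyVal (U x) z := by
  induction c using Polynomial.induction_on with
  | C r => simp [ContinuousLinearMap.algebraMap_apply, hardyVal_smul, hz]
  | add p q hp hq => simp [hardyVal_add, hz, hp, hq, add_smul]
  | monomial n r h =>
    rw [pow_succ', mul_left_comm, map_mul, aeval_X, mul_apply_eq_comp, hS _ _ hz, h]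
    simp [smul_smul]

theorem hardyVal_pow
    (hT : ∀ (x : H) (z : ℂ), ‖z‖ < 1 → hardyVal (U (T x)) z = (Φ z).mulVec (hardyVal (U x) z))
    (n : ℕ) (x : H) {z : ℂ} (hz : ‖z‖ < 1) :
    hardyVal (U ((T ^ n) x)) z = (Φ z ^ n).mulVec (hardyVal (U x) z) := by
  induction n with
  | zero => simp
  | succ n ih => rw [pow_succ', pow_succ', mul_apply_eq_comp, hT _ _ hz, ih, Matrix.mulVec_mulVec]

theorem hardyVal_bivariateOp
    (hS : ∀ (x : H) (z : ℂ), ‖z‖ < 1 → hardyVal (U (S x)) z = z • hardyVal (U x) z)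
    (hT : ∀ (x : H) (z : ℂ), ‖z‖ < 1 → hardyVal (U (T x)) z = (Φ z).mulVec (hardyVal (U x) z))
    (F : ℂ[X][Y]) (x : H) {z : ℂ} (hz : ‖z‖ < 1) :
    hardyVal (U (bivariateOp F S T x)) z = (matrixVal F z (Φ z)).mulVec (hardyVal (U x) z) := by
  induction F using Polynomial.induction_on' with
  | add p q hp hq =>
    simp only [bivariateOp, matrixVal, eval₂_add, Polynomial.map_add, map_add,
      add_apply, hardyVal_add _ _ hz, Matrix.add_mulVec] at *
    rw [hp, hq]
  | monomial n c =>
    simp only [bivariateOp, matrixVal, eval₂_monomial, Polynomial.map_monomial, aeval_monomial]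
    rw [mul_apply_eq_comp]
    erw [hardyVal_aeval hS c _ hz, hardyVal_pow hT n x hz]
    simp [Algebra.algebraMap_eq_smul_one, Matrix.smul_mulVec]

/-- An operator modeled by multiplication by `z` shifts the Taylor coefficients. -/
theorem map_single_eq
    (hS : ∀ (x : H) (z : ℂ), ‖z‖ < 1 → hardyVal (U (S x)) z = z • hardyVal (U x) z)
    (n : ℕ) (v : EuclideanSpace ℂ (Fin M)) :
    U (S (U.symm (lp.single 2 n v))) = lp.single 2 (n + 1) v := by
  refine hardyVal_injective fun z hz => ?_
  rw [hS _ _ hz, U.apply_symm_apply, hardyVal_single, hardyVal_single, smul_smul, pow_succ']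

/-- A relation `F(S,T) = 0` holds pointwise for the symbol, since constant functions take all values. -/
theorem matrixVal_eq_zero
    (hS : ∀ (x : H) (z : ℂ), ‖z‖ < 1 → hardyVal (U (S x)) z = z • hardyVal (U x) z)
    (hT : ∀ (x : H) (z : ℂ), ‖z‖ < 1 → hardyVal (U (T x)) z = (Φ z).mulVec (hardyVal (U x) z))
    {F : ℂ[X][Y]} (hF : bivariateOp F S T = 0) {z : ℂ} (hz : ‖z‖ < 1) :
    matrixVal F z (Φ z) = 0 := by
  refine Matrix.ext_of_mulVec_single fun i => ?_
  have h := hardyVal_bivariateOp hS hT F (U.symm (lp.single 2 0 (EuclideanSpace.single i 1))) hz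
  rw [U.apply_symm_apply, hardyVal_single, hF] at h
  simp only [pow_zero, one_smul] at h
  have h0 : hardyVal (U ((0 : H →L[ℂ] H) (U.symm (lp.single 2 0 (EuclideanSpace.single i 1))))) z
      = 0 := by
    rw [zero_apply, map_zero, ← hardyEval_apply hz, map_zero]
  rw [h0] at h
  rw [EuclideanSpace.single, PiLp.ofLp_single] at h
  rw [← h, Matrix.zero_mulVec]

theorem bivariateOp_eq_zero
    (hS : ∀ (x : H) (z : ℂ), ‖z‖ < 1 → hardyVal (U (S x)) z = z • hardyVal (U x) z)
    (hT : ∀ (x : H) (z : ℂ), ‖z‖ < 1 → hardyVal (U (T x)) z = (Φ z).mulVec (hardyVal (U x) z))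
    {F : ℂ[X][Y]} (hF : ∀ z : ℂ, ‖z‖ < 1 → matrixVal F z (Φ z) = 0) :
    bivariateOp F S T = 0 := by
  ext x
  apply U.injective
  rw [zero_apply, map_zero]
  refine eq_zero_of_hardyVal_eq_zero fun z hz => ?_
  rw [hardyVal_bivariateOp hS hT F x hz, hF z hz, Matrix.zero_mulVec]

variable [CompleteSpace H]

theorem mem_jointKer_iff {a b : ℂ} {x : H} : x ∈ jointKer S T a b ↔
    ∀ y, inner ℂ x (S y) = a * inner ℂ x y ∧ inner ℂ x (T y) = b * inner ℂ x y := by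
  have key : ∀ (W : H →L[ℂ] H) (c : ℂ),
      ContinuousLinearMap.adjoint (W - c • (1 : H →L[ℂ] H)) x = 0 ↔
        ∀ y, inner ℂ x (W y) = c * inner ℂ x y := by
    intro W c
    rw [ext_iff_inner_right ℂ]
    refine forall_congr' fun y => ?_
    rw [ContinuousLinearMap.adjoint_inner_left, inner_zero_left]
    simp [inner_sub_right, inner_smul_right, sub_eq_zero]
  simp only [jointKer, Submodule.mem_inf, LinearMap.mem_ker, forall_and]
  exact and_congr (key S a) (key T b)

/-- The eigenvectors of the adjoint of `M_z` at `conj a` are the Szegő kernels at `a`, on which the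
adjoint of `M_Φ` acts through the conjugate transpose of `Φ a`. Hence the joint eigenspace is a copy
of the kernel of `(Φ a - b)ᴴ`. -/
theorem jointKer_eq_map
    (hS : ∀ (x : H) (z : ℂ), ‖z‖ < 1 → hardyVal (U (S x)) z = z • hardyVal (U x) z)
    (hT : ∀ (x : H) (z : ℂ), ‖z‖ < 1 → hardyVal (U (T x)) z = (Φ z).mulVec (hardyVal (U x) z))
    {a : ℂ} (b : ℂ) (ha : ‖a‖ < 1) :
    jointKer S T a b = Submodule.map (U.symm.toLinearEquiv.toLinearMap ∘ₗ szegoKernel ha)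
      (LinearMap.ker (Matrix.mulVecLin (Φ a - b • 1).conjTranspose)) := by
  have inn : ∀ (v : Fin M → ℂ) (y : H),
      inner ℂ (U.symm (szegoKernel ha v)) y = star v ⬝ᵥ hardyVal (U y) a := by
    intro v y
    rw [← inner_szegoKernel ha, ← U.inner_map_map, U.apply_symm_apply]
  ext x
  rw [mem_jointKer_iff, Submodule.mem_map]
  constructor
  · intro h
    have hrec : ∀ n, (U x) (n + 1) = starRingEnd ℂ a • (U x) n := by
      intro n
      refine ext_inner_right ℂ fun v => ?_
      have h1 := (h (U.symm (lp.single 2 n v))).1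
      rw [← U.inner_map_map, map_single_eq hS, ← U.inner_map_map x, U.apply_symm_apply,
        lp.inner_single_right, lp.inner_single_right] at h1
      rw [h1, inner_smul_left, Complex.conj_conj]
    have hx : x = U.symm (szegoKernel ha (WithLp.ofLp ((U x) 0))) := by
      rw [LinearIsometryEquiv.eq_symm_apply]
      ext n : 2
      rw [szegoKernel_coeff]
      induction n with
      | zero => simp
      | succ n ih => rw [hrec, ih, smul_smul, pow_succ']
    refine ⟨WithLp.ofLp ((U x) 0), ?_, hx.symm⟩
    set v := WithLp.ofLp ((U x) 0)
    rw [LinearMap.mem_ker, Matrix.mulVecLin_apply]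
    have h3 : Matrix.vecMul (star v) (Φ a - b • 1) = 0 := by
      refine dotProduct_eq_zero_iff.1 fun w => ?_
      have h2 := (h (U.symm (lp.single 2 0 (WithLp.toLp 2 w)))).2
      rw [hx, inn, inn, hT _ _ ha, U.apply_symm_apply, hardyVal_single] at h2
      rw [← Matrix.dotProduct_mulVec, Matrix.sub_mulVec, dotProduct_sub, Matrix.smul_mulVec,
        Matrix.one_mulVec, dotProduct_smul]
      simpa [sub_eq_zero] using h2
    rw [Matrix.mulVec_conjTranspose, h3, star_zero]
  · rintro ⟨v, hv, rfl⟩ y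
    rw [LinearMap.mem_ker, Matrix.mulVecLin_apply, Matrix.mulVec_conjTranspose, star_eq_zero] at hv
    simp only [LinearMap.comp_apply, LinearEquiv.coe_coe]
    erw [inn, inn, inn]
    rw [hS _ _ ha, hT _ _ ha]
    refine ⟨by rw [dotProduct_smul, smul_eq_mul], ?_⟩
    have h3 := congrArg (fun u => u ⬝ᵥ hardyVal (U y) a) hv
    simp only [← Matrix.dotProduct_mulVec, Matrix.sub_mulVec, dotProduct_sub, Matrix.smul_mulVec,
      Matrix.one_mulVec, dotProduct_smul, zero_dotProduct, sub_eq_zero, smul_eq_mul] at h3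
    exact h3

open scoped ComplexOrder in
theorem finrank_jointKer
    (hS : ∀ (x : H) (z : ℂ), ‖z‖ < 1 → hardyVal (U (S x)) z = z • hardyVal (U x) z)
    (hT : ∀ (x : H) (z : ℂ), ‖z‖ < 1 → hardyVal (U (T x)) z = (Φ z).mulVec (hardyVal (U x) z))
    {a : ℂ} (b : ℂ) (ha : ‖a‖ < 1) :
    Module.finrank ℂ (jointKer S T a b) =
      Module.finrank ℂ (Module.End.eigenspace (Matrix.toLin' (Φ a)) b) := by
  rw [jointKer_eq_map hS hT b ha, ← (Submodule.equivMapOfInjective _ ?_ _).finrank_eq]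
  · have h1 := LinearMap.finrank_range_add_finrank_ker (Φ a - b • 1).mulVecLin
    have h2 := LinearMap.finrank_range_add_finrank_ker (Φ a - b • 1).conjTranspose.mulVecLin
    have h3 := Matrix.rank_conjTranspose (Φ a - b • 1)
    have h4 : Module.End.eigenspace (Matrix.toLin' (Φ a)) b =
        LinearMap.ker (Φ a - b • 1).mulVecLin := by
      ext v
      simp [sub_eq_zero]
    rw [Matrix.rank, Matrix.rank] at h3
    rw [h4]
    omega
  · refine U.symm.injective.comp fun v w h => ?_
    have h0 := congrArg (fun f : HardySpace M => f 0) h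
    simpa [szegoKernel_coeff] using h0

end Model

/-! ### Existence of a rational inner symbol -/

/-- The transfer function `D + z C (1 - z A)⁻¹ B` of a finite-dimensional system is rational, with
denominator `det (1 - X A)`. Its value at `v` is described through the state `k = (1 - z A)⁻¹ B v`. -/
theorem exists_transfer_function {M : ℕ} {K : Type*} [AddCommGroup K] [Module ℂ K]
    [FiniteDimensional ℂ K] (A : Module.End ℂ K) (B : (Fin M → ℂ) →ₗ[ℂ] K)
    (C' : K →ₗ[ℂ] (Fin M → ℂ)) (D : (Fin M → ℂ) →ₗ[ℂ] (Fin M → ℂ))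
    (hA : ∀ z : ℂ, ‖z‖ ≤ 1 → ∀ k, k = z • A k → k = 0) :
    ∃ (q : ℂ[X]) (P : Matrix (Fin M) (Fin M) ℂ[X]) (Φ : ℂ → Matrix (Fin M) (Fin M) ℂ),
      (∀ z : ℂ, ‖z‖ ≤ 1 → q.eval z ≠ 0 ∧ q.eval z • Φ z = P.map (Polynomial.eval z)) ∧
      ∀ z : ℂ, ‖z‖ ≤ 1 → ∀ v, ∃ k, k - z • A k = B v ∧ (Φ z).mulVec v = D v + z • C' k := by
  classical
  let bK := Module.finBasis ℂ K
  let b := Pi.basisFun ℂ (Fin M)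
  let R : Matrix (Fin (Module.finrank ℂ K)) (Fin (Module.finrank ℂ K)) ℂ[X] :=
    1 - (X : ℂ[X]) • (LinearMap.toMatrix bK bK A).map C
  let q := R.det
  let P : Matrix (Fin M) (Fin M) ℂ[X] := q • (LinearMap.toMatrix b b D).map C +
    (X : ℂ[X]) • ((LinearMap.toMatrix bK b C').map C * R.adjugate * (LinearMap.toMatrix b bK B).map C)
  have hmC : ∀ {m n : ℕ} (N : Matrix (Fin m) (Fin n) ℂ) (z : ℂ),
      (N.map C).map (Polynomial.eval z) = N := by
    intro m n N z; ext i j; simp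
  have hR : ∀ z : ℂ, R.map (Polynomial.eval z) = LinearMap.toMatrix bK bK (1 - z • A) := by
    intro z
    ext i j
    rw [map_sub, map_smul, LinearMap.toMatrix_one]
    simp only [R, Matrix.map_apply, Matrix.sub_apply, Matrix.smul_apply, Matrix.one_apply]
    split_ifs <;> · simp; ring
  have hq : ∀ z : ℂ, q.eval z = (LinearMap.toMatrix bK bK (1 - z • A)).det := by
    intro z
    rw [← hR]
    exact (evalRingHom z).map_det R
  have hadj : ∀ z : ℂ, R.adjugate.map (Polynomial.eval z) =
      (LinearMap.toMatrix bK bK (1 - z • A)).adjugate := by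
    intro z
    rw [← hR]
    exact (evalRingHom z).map_adjugate R
  have hP : ∀ z : ℂ, P.map (Polynomial.eval z) = q.eval z • LinearMap.toMatrix b b D +
      z • (LinearMap.toMatrix bK b C' * (LinearMap.toMatrix bK bK (1 - z • A)).adjugate *
        LinearMap.toMatrix b bK B) := by
    intro z
    rw [← hadj]
    conv_rhs => rw [← hmC (LinearMap.toMatrix bK b C') z, ← hmC (LinearMap.toMatrix b bK B) z,
      ← hmC (LinearMap.toMatrix b b D) z]
    have h : ∀ {l m n : ℕ} (N : Matrix (Fin l) (Fin m) ℂ[X]) (N' : Matrix (Fin m) (Fin n) ℂ[X]),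
        (N * N').map (Polynomial.eval z) = N.map (Polynomial.eval z) * N'.map (Polynomial.eval z) :=
      fun N N' => Matrix.map_mul (f := evalRingHom z)
    rw [← h, ← h]
    ext i j
    simp [P]
  have hdet : ∀ z : ℂ, ‖z‖ ≤ 1 → q.eval z ≠ 0 := by
    intro z hz
    rw [hq, LinearMap.det_toMatrix, ← isUnit_iff_ne_zero, ← LinearMap.isUnit_iff_isUnit_det,
      LinearMap.isUnit_iff_ker_eq_bot, LinearMap.ker_eq_bot']
    intro k hk
    refine hA z hz k ?_
    simpa [sub_eq_zero] using hk
  refine ⟨q, P, fun z => (q.eval z)⁻¹ • P.map (Polynomial.eval z), fun z hz => ⟨hdet z hz, ?_⟩, ?_⟩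
  · rw [smul_smul, mul_inv_cancel₀ (hdet z hz), one_smul]
  · intro z hz v
    let L := Matrix.toLin bK bK (LinearMap.toMatrix bK bK (1 - z • A)).adjugate
    have hL : (1 - z • A) ∘ₗ L = q.eval z • LinearMap.id := by
      apply (LinearMap.toMatrix bK bK).injective
      rw [LinearMap.toMatrix_comp bK bK bK, LinearMap.toMatrix_toLin, Matrix.mul_adjugate, ← hq,
        map_smul, LinearMap.toMatrix_id]
    have hN : ∀ u, (P.map (Polynomial.eval z)).mulVec u =
        q.eval z • D u + z • C' (L (B u)) := by
      intro u
      have : Matrix.toLin b b (P.map (Polynomial.eval z)) = q.eval z • D + z • (C' ∘ₗ L ∘ₗ B) := by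
        apply (LinearMap.toMatrix b b).injective
        rw [LinearMap.toMatrix_toLin, hP, map_add, map_smul, map_smul,
          LinearMap.toMatrix_comp b bK b, LinearMap.toMatrix_comp b bK bK,
          LinearMap.toMatrix_toLin, Matrix.mul_assoc]
      have h2 := LinearMap.congr_fun this u
      simpa [b, Matrix.toLin_eq_toLin'] using h2
    refine ⟨(q.eval z)⁻¹ • L (B v), ?_, ?_⟩
    · have h2 := LinearMap.congr_fun hL (B v)
      simp only [LinearMap.comp_apply, LinearMap.sub_apply, LinearMap.smul_apply, Module.End.one_apply,
        LinearMap.id_apply] at h2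
      rw [map_smul, smul_comm z, ← smul_sub, h2, smul_smul, inv_mul_cancel₀ (hdet z hz), one_smul]
    · rw [Matrix.smul_mulVec, hN, smul_add, smul_smul, inv_mul_cancel₀ (hdet z hz), one_smul,
        map_smul, smul_comm z]

theorem mem_unitaryGroup_of_norm_mulVec {M : ℕ} {A : Matrix (Fin M) (Fin M) ℂ}
    (hA : ∀ v : Fin M → ℂ, ‖WithLp.toLp 2 (A.mulVec v)‖ = ‖WithLp.toLp 2 v‖) :
    A ∈ Matrix.unitaryGroup (Fin M) ℂ := by
  let L : EuclideanSpace ℂ (Fin M) →ₗᵢ[ℂ] EuclideanSpace ℂ (Fin M) :=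
    ⟨Matrix.toEuclideanLin A, fun v => hA v.ofLp⟩
  rw [Matrix.mem_unitaryGroup_iff']
  ext i j
  have h := L.inner_map_map (EuclideanSpace.single i 1) (EuclideanSpace.single j 1)
  have e : ∀ k, L (EuclideanSpace.single k 1) = WithLp.toLp 2 (A.col k) := by
    intro k
    change Matrix.toEuclideanLin A (EuclideanSpace.single k 1) = _
    rw [Matrix.toLpLin_apply]
    simp
  rw [e, e, EuclideanSpace.inner_single_left] at h
  simp only [PiLp.inner_apply, RCLike.inner_apply, map_one, one_mul] at h
  simp only [Matrix.star_eq_conjTranspose, Matrix.mul_apply, Matrix.conjTranspose_apply,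
    Matrix.one_apply]
  convert h using 1
  · exact Finset.sum_congr rfl fun k _ => by simp [mul_comm]
  · simp

section Wold

variable {H : Type*} [NormedAddCommGroup H] [InnerProductSpace ℂ H] [CompleteSpace H]

omit [CompleteSpace H] in
theorem inner_map_map_of_norm {S : H →L[ℂ] H} (hS : ∀ x, ‖S x‖ = ‖x‖) (x y : H) :
    inner ℂ (S x) (S y) = inner ℂ x y :=
  (⟨S.toLinearMap, hS⟩ : H →ₗᵢ[ℂ] H).inner_map_map x y

theorem adjoint_apply_self {S : H →L[ℂ] H} (hS : ∀ x, ‖S x‖ = ‖x‖) (x : H) :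
    ContinuousLinearMap.adjoint S (S x) = x :=
  ext_inner_right ℂ fun y => by
    rw [ContinuousLinearMap.adjoint_inner_left, inner_map_map_of_norm hS]

omit [CompleteSpace H] in
theorem norm_pow_apply {S : H →L[ℂ] H} (hS : ∀ x, ‖S x‖ = ‖x‖) (n : ℕ) (x : H) :
    ‖(S ^ n) x‖ = ‖x‖ := by
  induction n with
  | zero => simp
  | succ n ih => rw [pow_succ', mul_apply_eq_comp, hS, ih]

theorem exists_eq_of_norm_adjoint {S : H →L[ℂ] H} (hS : ∀ x, ‖S x‖ = ‖x‖) {x : H}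
    (hx : ‖x‖ ≤ ‖ContinuousLinearMap.adjoint S x‖) :
    S (ContinuousLinearMap.adjoint S x) = x := by
  have h := norm_sub_sq (𝕜 := ℂ) x (S (ContinuousLinearMap.adjoint S x))
  rw [← ContinuousLinearMap.adjoint_inner_left, inner_self_eq_norm_sq, hS] at h
  have h2 : ‖x - S (ContinuousLinearMap.adjoint S x)‖ ^ 2 ≤ 0 := by
    nlinarith [norm_nonneg x]
  have h3 := pow_eq_zero_iff (two_ne_zero) |>.1 (le_antisymm h2 (by positivity))
  exact (sub_eq_zero.1 (norm_eq_zero.1 h3)).symm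

/-- The adjoint of a pure isometry has no eigenvalue of modulus at least `1`. -/
theorem eq_zero_of_eq_smul_adjoint {S : H →L[ℂ] H} (hS : IsPureIsometry S) {z : ℂ}
    (hz : ‖z‖ ≤ 1) {x : H} (hx : x = z • ContinuousLinearMap.adjoint S x) : x = 0 := by
  have h1 : ‖x‖ ≤ ‖ContinuousLinearMap.adjoint S x‖ := by
    conv_lhs => rw [hx, norm_smul]
    exact mul_le_of_le_one_left (norm_nonneg _) hz
  have h2 := exists_eq_of_norm_adjoint hS.1 h1
  have h3 : S x = z • x := by
    conv_lhs => rw [hx, map_smul, h2]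
  rcases eq_or_ne z 0 with rfl | hz0
  · simpa using hx
  have h4 : S (z⁻¹ • x) = x := by rw [map_smul, h3, smul_smul, inv_mul_cancel₀ hz0, one_smul]
  refine hS.2 x fun n => ⟨z⁻¹ ^ n • x, ?_⟩
  induction n with
  | zero => simp
  | succ n ih => rw [pow_succ S, mul_apply_eq_comp, pow_succ z⁻¹, mul_smul, map_smul, h4, ih]

/-- The Wold decomposition: a pure isometry of multiplicity `M` is the shift on the Hardy space. -/
theorem exists_wold {S : H →L[ℂ] H} (hS : IsPureIsometry S) {M : ℕ} (hM : HasMultiplicity S M) :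
    ∃ U : H ≃ₗᵢ[ℂ] HardySpace M, ∀ (n : ℕ) (v : EuclideanSpace ℂ (Fin M)),
      U (S (U.symm (lp.single 2 n v))) = lp.single 2 (n + 1) v := by
  obtain ⟨hfin, hdim⟩ := hM
  set E := LinearMap.ker (ContinuousLinearMap.adjoint S).toLinearMap with hE
  have memE : ∀ x, x ∈ E ↔ ContinuousLinearMap.adjoint S x = 0 := fun x => LinearMap.mem_ker
  let e := ((stdOrthonormalBasis ℂ E).reindex (finCongr hdim)).repr.symm
  have he : ∀ v n y, inner ℂ ((e v : E) : H) ((S ^ (n + 1)) y) = 0 := by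
    intro v n y
    rw [pow_succ', mul_apply_eq_comp, ← ContinuousLinearMap.adjoint_inner_left,
      (memE _).1 (e v).2, inner_zero_left]
  let V : ℕ → EuclideanSpace ℂ (Fin M) →ₗᵢ[ℂ] H := fun n =>
    ⟨(S ^ n).toLinearMap ∘ₗ E.subtype ∘ₗ e.toLinearEquiv.toLinearMap, fun v => by
      have : ‖(S ^ n) ((e v : E) : H)‖ = ‖v‖ := by
        rw [norm_pow_apply hS.1]; exact e.norm_map v
      exact this⟩
  have hVapp : ∀ n v, V n v = (S ^ n) ((e v : E) : H) := fun n v => rfl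
  have hpow : ∀ n x y, inner ℂ ((S ^ n) x) ((S ^ n) y) = inner ℂ x y := fun n =>
    inner_map_map_of_norm (norm_pow_apply hS.1 n)
  have hlt : ∀ m n v w, m < n → inner ℂ (V m v) (V n w) = 0 := by
    intro m n v w hmn
    obtain ⟨k, rfl⟩ := Nat.exists_eq_add_of_lt hmn
    rw [hVapp, hVapp, add_assoc, pow_add, mul_apply_eq_comp, hpow, he]
  have hortho : OrthogonalFamily ℂ (fun _ : ℕ => EuclideanSpace ℂ (Fin M)) V := by
    intro m n hmn v w
    rcases lt_or_gt_of_ne hmn with h | h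
    · exact hlt m n v w h
    · rw [← inner_conj_symm, hlt n m w v h, map_zero]
  -- a vector orthogonal to all `S ^ n ker S*` lies in the range of every `S ^ n`
  have htot : ⊤ ≤ (⨆ i, LinearMap.range (V i).toLinearMap).topologicalClosure := by
    rw [top_le_iff, Submodule.topologicalClosure_eq_top_iff, Submodule.eq_bot_iff]
    intro x hx
    have hx' : ∀ n, ∀ v, inner ℂ (V n v) x = 0 := fun n v =>
      (Submodule.mem_orthogonal _ _).1 hx _ (Submodule.mem_iSup_of_mem n ⟨v, rfl⟩)
    have hE' : ∀ n u, u ∈ E → inner ℂ ((S ^ n) u) x = 0 := by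
      intro n u hu
      have := hx' n (e.symm ⟨u, hu⟩)
      rwa [hVapp, LinearIsometryEquiv.apply_symm_apply] at this
    refine hS.2 x fun n => ?_
    refine ⟨(ContinuousLinearMap.adjoint S ^ n) x, ?_⟩
    induction n with
    | zero => simp
    | succ n ih =>
      set y := (ContinuousLinearMap.adjoint S ^ n) x with hy
      have hyE : ∀ u ∈ E, inner ℂ u y = 0 := by
        intro u hu
        rw [← hpow n, ih]
        exact hE' n u hu
      have h1 : S (ContinuousLinearMap.adjoint S y) = y := by
        have hmem : y - S (ContinuousLinearMap.adjoint S y) ∈ E := by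
          rw [memE, map_sub, adjoint_apply_self hS.1, sub_self]
        have h2 := hyE _ hmem
        have h3 : inner ℂ (y - S (ContinuousLinearMap.adjoint S y))
            (S (ContinuousLinearMap.adjoint S y)) = 0 := by
          rw [← ContinuousLinearMap.adjoint_inner_left, (memE _).1 hmem, inner_zero_left]
        have h4 : inner ℂ (y - S (ContinuousLinearMap.adjoint S y))
            (y - S (ContinuousLinearMap.adjoint S y)) = 0 := by
          rw [inner_sub_right, h2, h3, sub_zero]
        exact (sub_eq_zero.1 (inner_self_eq_zero.1 h4)).symm
      rw [pow_succ S, mul_apply_eq_comp, pow_succ', mul_apply_eq_comp, ← hy, h1, ih]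
  refine ⟨(IsHilbertSum.mk hortho htot).linearIsometryEquiv, fun n v => ?_⟩
  rw [← LinearIsometryEquiv.eq_symm_apply, IsHilbertSum.linearIsometryEquiv_symm_apply_single,
    IsHilbertSum.linearIsometryEquiv_symm_apply_single, hVapp, hVapp, pow_succ', mul_apply_eq_comp]

section Shift

variable {M : ℕ} {S : H →L[ℂ] H} {U : H ≃ₗᵢ[ℂ] HardySpace M}

theorem coeff_succ (hU : ∀ (n : ℕ) (v : EuclideanSpace ℂ (Fin M)),
      U (S (U.symm (lp.single 2 n v))) = lp.single 2 (n + 1) v) (x : H) (n : ℕ) :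
    U x (n + 1) = U (ContinuousLinearMap.adjoint S x) n := by
  refine ext_inner_right ℂ fun v => ?_
  rw [← lp.inner_single_right, ← lp.inner_single_right, ← hU, U.inner_map_map,
    ← ContinuousLinearMap.adjoint_inner_left, ← U.inner_map_map, U.apply_symm_apply]

/-- The backward shift: the adjoint of `S` acts as `f ↦ (f - f 0) / z`. -/
theorem hardyVal_eq_coeff_zero_add (hU : ∀ (n : ℕ) (v : EuclideanSpace ℂ (Fin M)),
      U (S (U.symm (lp.single 2 n v))) = lp.single 2 (n + 1) v) (x : H) {z : ℂ} (hz : ‖z‖ < 1) :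
    hardyVal (U x) z = U x 0 + z • hardyVal (U (ContinuousLinearMap.adjoint S x)) z := by
  ext i
  refine (hasSum_hardyVal (U x) hz i).unique ?_
  rw [← hasSum_nat_add_iff' 1]
  have h := (hasSum_hardyVal (U (ContinuousLinearMap.adjoint S x)) hz i).mul_left z
  simp only [Finset.range_one, Finset.sum_singleton, pow_zero, mul_one, Pi.add_apply, Pi.smul_apply,
    smul_eq_mul, add_sub_cancel_left]
  convert! h using 1
  ext n
  rw [coeff_succ hU, pow_succ]
  ring

/-- The constant coefficient of `U x` is the component of `x` in `ker S*`, and `S` is isometric on the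
rest. -/
theorem norm_sq_eq_coeff_zero_add (hU : ∀ (n : ℕ) (v : EuclideanSpace ℂ (Fin M)),
      U (S (U.symm (lp.single 2 n v))) = lp.single 2 (n + 1) v) (x : H) :
    ‖x‖ ^ 2 = ‖U x 0‖ ^ 2 + ‖ContinuousLinearMap.adjoint S x‖ ^ 2 := by
  have h : ∀ f : HardySpace M, HasSum (fun n => ‖f n‖ ^ 2) (‖f‖ ^ 2) := by
    intro f
    simpa using lp.hasSum_norm (p := 2) (by norm_num) f
  have h1 := h (U x)
  have h2 := h (U (ContinuousLinearMap.adjoint S x))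
  rw [U.norm_map] at h1 h2
  rw [← hasSum_nat_add_iff' 1] at h1
  simp only [coeff_succ hU] at h1
  have := h1.unique h2
  simp at this
  linarith

omit [CompleteSpace H] in
/-- A bounded operator which commutes with the shift is determined, pointwise in the disk, by its
action on constant functions. -/
theorem hardyVal_of_commute {T : H →L[ℂ] H} (hST : S * T = T * S) {z : ℂ} (hz : ‖z‖ < 1)
    (hU : ∀ (n : ℕ) (v : EuclideanSpace ℂ (Fin M)),
      U (S (U.symm (lp.single 2 n v))) = lp.single 2 (n + 1) v)
    (hS : ∀ x : H, hardyVal (U (S x)) z = z • hardyVal (U x) z)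
    {A : Matrix (Fin M) (Fin M) ℂ}
    (hA : ∀ v : EuclideanSpace ℂ (Fin M),
      hardyVal (U (T (U.symm (lp.single 2 0 v)))) z = A.mulVec v) (x : H) :
    hardyVal (U (T x)) z = A.mulVec (hardyVal (U x) z) := by
  let L₁ : HardySpace M →L[ℂ] (Fin M → ℂ) :=
    hardyEval hz ∘L (U : H →L[ℂ] HardySpace M) ∘L T ∘L (U.symm : HardySpace M →L[ℂ] H)
  let L₂ : HardySpace M →L[ℂ] (Fin M → ℂ) :=
    (LinearMap.toContinuousLinearMap A.mulVecLin) ∘L hardyEval hz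
  have hsingle : ∀ n v, L₁ (lp.single 2 n v) = L₂ (lp.single 2 n v) := by
    intro n v
    change hardyEval hz (U (T (U.symm (lp.single 2 n v)))) = A.mulVec (hardyEval hz _)
    rw [hardyEval_apply, hardyEval_apply]
    induction n with
    | zero => rw [hA, hardyVal_single, pow_zero, one_smul]
    | succ n ih =>
      have h1 := congrArg (fun W : H →L[ℂ] H => W (U.symm (lp.single 2 n v))) hST
      simp only [mul_apply_eq_comp] at h1
      rw [← hU, U.symm_apply_apply, ← h1, hS, ih, hS, U.apply_symm_apply, Matrix.mulVec_smul]
  have hL : L₁ (U x) = L₂ (U x) := by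
    have h := lp.hasSum_single (p := 2) (by norm_num) (U x)
    refine (h.mapL L₁).unique ?_
    simp only [hsingle]
    exact h.mapL L₂
  have h2 : hardyEval hz (U (T (U.symm (U x)))) = A.mulVec (hardyEval hz (U x)) := hL
  rwa [U.symm_apply_apply, hardyEval_apply, hardyEval_apply] at h2

end Shift

/-- Since `ker T*` is finite-dimensional, invariant under `S*`, and contains `S* T v` for `v ∈ ker S*`,
the symbol of `T` is the transfer function with state space `ker T*`. It is unitary on the circle
because `T v + k`, for `v ∈ ker S*` and `k ∈ ker T*`, splits orthogonally in two ways. -/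
theorem exists_isModel {S T : H →L[ℂ] H} (hS : IsPureIsometry S) (hT : ∀ x, ‖T x‖ = ‖x‖)
    (hST : S * T = T * S) {M N : ℕ} (hM : HasMultiplicity S M) (hN : HasMultiplicity T N) :
    ∃ Φ : ℂ → Matrix (Fin M) (Fin M) ℂ, IsModel S T Φ := by
  obtain ⟨U, hU⟩ := exists_wold hS hM
  let S' := ContinuousLinearMap.adjoint S
  let T' := ContinuousLinearMap.adjoint T
  have hSval : ∀ (x : H) (z : ℂ), ‖z‖ < 1 → hardyVal (U (S x)) z = z • hardyVal (U x) z := by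
    intro x z hz
    have h0 : U (S x) 0 = 0 := by
      have := norm_sq_eq_coeff_zero_add hU (S x)
      rw [adjoint_apply_self hS.1, hS.1] at this
      simpa using this
    rw [hardyVal_eq_coeff_zero_add hU (S x) hz, h0, adjoint_apply_self hS.1]
    simp
  have hST' : ∀ x, T' (S' x) = S' (T' x) := by
    intro x
    refine ext_inner_right ℂ fun y => ?_
    have h1 := congrArg (fun W : H →L[ℂ] H => W y) hST
    simp only [mul_apply_eq_comp] at h1
    simp only [S', T', ContinuousLinearMap.adjoint_inner_left, h1]
  let K : Submodule ℂ H := LinearMap.ker T'.toLinearMap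
  have : FiniteDimensional ℂ K := hN.1
  have memK : ∀ x, x ∈ K ↔ T' x = 0 := fun x => LinearMap.mem_ker
  have hKS : ∀ x ∈ K, S' x ∈ K := fun x hx => by
    rw [memK] at hx ⊢
    rw [hST', hx, map_zero]
  let c : (Fin M → ℂ) →ₗ[ℂ] H := {
    toFun := fun v => U.symm (lp.single 2 0 (WithLp.toLp 2 v))
    map_add' := fun v w => by simp
    map_smul' := fun r v => by simp [lp.single_smul] }
  have hc : ∀ v, S' (c v) = 0 := by
    intro v
    have := norm_sq_eq_coeff_zero_add hU (c v)
    have h2 : U (c v) 0 = WithLp.toLp 2 v := by simp [c]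
    have h3 : ‖c v‖ = ‖WithLp.toLp 2 v‖ := by simp [c, lp.norm_single]
    rw [h2, h3] at this
    simpa using this
  let A : Module.End ℂ K := S'.toLinearMap.restrict hKS
  let B : (Fin M → ℂ) →ₗ[ℂ] K := LinearMap.codRestrict K (S'.toLinearMap ∘ₗ T.toLinearMap ∘ₗ c)
    fun v => by
      change S' (T (c v)) ∈ K
      rw [memK, hST', adjoint_apply_self hT, hc]
  let C₀ : H →ₗ[ℂ] (Fin M → ℂ) := {
    toFun := fun x => WithLp.ofLp (U x 0)
    map_add' := fun v w => by simp
    map_smul' := fun r v => by simp }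
  obtain ⟨q, P, Φ, h1, h2⟩ := exists_transfer_function A B (C₀ ∘ₗ K.subtype)
    (C₀ ∘ₗ T.toLinearMap ∘ₗ c) (fun z hz k hk => by
      have := congrArg (Subtype.val) hk
      exact Subtype.ext (eq_zero_of_eq_smul_adjoint hS hz this))
  refine ⟨Φ, ⟨⟨q, P, h1⟩, fun z hz => ?_⟩, U, fun x z hz => ⟨hSval x z hz, ?_⟩⟩
  · refine mem_unitaryGroup_of_norm_mulVec fun v => ?_
    obtain ⟨k, hk1, hk2⟩ := h2 z hz.le v
    have hk1' : (k : H) - z • S' k = S' (T (c v)) := congrArg Subtype.val hk1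
    -- the colligation identity: compute the norm of `T (c v) + z • k` in two ways
    have e1 : ‖T (c v) + z • (k : H)‖ ^ 2 = ‖WithLp.toLp 2 v‖ ^ 2 + ‖(k : H)‖ ^ 2 := by
      have h0 : inner ℂ (T (c v)) (z • (k : H)) = 0 := by
        rw [← ContinuousLinearMap.adjoint_inner_right, map_smul]
        have : T' k = 0 := (memK _).1 k.2
        change inner ℂ (c v) (z • T' k) = 0
        rw [this, smul_zero, inner_zero_right]
      rw [norm_add_sq (𝕜 := ℂ), h0, hT, norm_smul, hz]
      simp [c, lp.norm_single]
    have e2 := norm_sq_eq_coeff_zero_add hU (T (c v) + z • (k : H))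
    have e3 : ContinuousLinearMap.adjoint S (T (c v) + z • (k : H)) = k := by
      rw [map_add, map_smul]
      change S' _ + z • S' _ = _
      rw [← hk1', sub_add_cancel]
    have e4 : U (T (c v) + z • (k : H)) 0 = WithLp.toLp 2 ((Φ z).mulVec v) := by
      rw [hk2]
      simp [C₀]
      rfl
    rw [e1, e3, e4] at e2
    have e5 : ‖WithLp.toLp 2 ((Φ z).mulVec v)‖ ^ 2 = ‖WithLp.toLp 2 v‖ ^ 2 := by linarith
    exact (pow_left_inj₀ (norm_nonneg _) (norm_nonneg _) two_ne_zero).1 e5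
  · refine hardyVal_of_commute hST hz hU (fun x => hSval x z hz) (fun v => ?_) x
    obtain ⟨k, hk1, hk2⟩ := h2 z hz.le v.ofLp
    have hk1' : (k : H) - z • S' k = S' (T (c v.ofLp)) := congrArg Subtype.val hk1
    change hardyVal (U (T (c v.ofLp))) z = _
    rw [hardyVal_eq_coeff_zero_add hU _ hz]
    change _ + z • hardyVal (U (S' (T (c v.ofLp)))) z = _
    rw [← hk1', map_sub, map_smul, hardyVal_sub _ _ hz, hardyVal_smul _ _ hz,
      hardyVal_eq_coeff_zero_add hU k hz, hk2]
    simp only [S', add_sub_cancel_right]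
    rfl

end Wold

/-! ### The characteristic polynomial of the symbol -/

theorem rootMultiplicity_prod_pow {s : ℕ} {f : Fin s → ℂ[X]} (hf : ∀ i, f i ≠ 0) (α : Fin s → ℕ)
    (b : ℂ) :
    (∏ i, f i ^ α i).rootMultiplicity b = ∑ i, α i * (f i).rootMultiplicity b := by
  classical
  have h : ∀ t : Finset (Fin s),
      (∏ i ∈ t, f i ^ α i).rootMultiplicity b = ∑ i ∈ t, α i * (f i).rootMultiplicity b := by
    intro t
    induction t using Finset.induction_on with
    | empty => simp [Polynomial.rootMultiplicity_eq_zero]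
    | insert i t hi ih =>
      rw [Finset.prod_insert hi, Finset.sum_insert hi, ← ih, Polynomial.rootMultiplicity_mul,
        ← Polynomial.count_roots, Polynomial.roots_pow, Multiset.count_nsmul,
        Polynomial.count_roots]
      exact mul_ne_zero (pow_ne_zero _ (hf i)) (Finset.prod_ne_zero_iff.2 fun j _ => pow_ne_zero _ (hf j))
  exact h _

theorem rootMultiplicity_of_simple_root_prod {s : ℕ} {f : Fin s → ℂ[X]} (hf : ∀ i, f i ≠ 0)
    {b : ℂ} {j : Fin s} (hb : (f j).eval b = 0) (hd : (derivative (∏ i, f i)).eval b ≠ 0)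
    (i : Fin s) : (f i).rootMultiplicity b = if i = j then 1 else 0 := by
  classical
  have h0 : ∏ i, f i ≠ 0 := Finset.prod_ne_zero_iff.2 fun i _ => hf i
  have h1 : (∏ i, f i).rootMultiplicity b ≤ 1 := by
    by_contra h
    exact hd ((Polynomial.one_lt_rootMultiplicity_iff_isRoot h0).1 (not_le.1 h)).2
  have h2 := rootMultiplicity_prod_pow hf (fun _ => 1) b
  simp only [pow_one, one_mul] at h2
  rw [h2, ← Finset.add_sum_erase _ _ (Finset.mem_univ j)] at h1
  have h3 : 1 ≤ (f j).rootMultiplicity b := (Polynomial.rootMultiplicity_pos (hf j)).2 hb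
  split_ifs with hij
  · subst hij; omega
  · have := Finset.single_le_sum (f := fun k => (f k).rootMultiplicity b)
      (fun _ _ => Nat.zero_le _) (Finset.mem_erase.2 ⟨hij, Finset.mem_univ i⟩)
    omega

theorem aeval_toLin_eq_zero {M : ℕ} {A : Matrix (Fin M) (Fin M) ℂ} {p : ℂ[X]}
    (hA : aeval A p = 0) : aeval (Matrix.toLin' A) p = 0 := by
  have := Polynomial.aeval_algHom_apply (Matrix.toLinAlgEquiv' (R := ℂ) (n := Fin M)).toAlgHom A p
  rw [hA, map_zero] at this
  exact this

/-- At a simple root of an annihilating polynomial `∏ f i`, the geometric multiplicity is read off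
from a factorization of the characteristic polynomial. -/
theorem finrank_eigenspace_of_charpoly {s M : ℕ} {f : Fin s → ℂ[X]} (hf : ∀ i, f i ≠ 0)
    {A : Matrix (Fin M) (Fin M) ℂ} {α : Fin s → ℕ} {d : ℂ} (hd : d ≠ 0)
    (hchar : C d * A.charpoly = ∏ i, f i ^ α i) (hA : aeval A (∏ i, f i) = 0)
    {b : ℂ} {j : Fin s} (hb : (f j).eval b = 0) (hb' : (derivative (∏ i, f i)).eval b ≠ 0) :
    Module.finrank ℂ (Module.End.eigenspace (Matrix.toLin' A) b) = α j := by
  have hA' := aeval_toLin_eq_zero hA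
  have hroot : (∏ i, f i).eval b = 0 := by
    rw [eval_prod]; exact Finset.prod_eq_zero (Finset.mem_univ j) hb
  rw [finrank_eigenspace_of_simple_root hA' hroot hb', Matrix.charpoly_toLin']
  have h := rootMultiplicity_prod_pow hf α b
  rw [← hchar, Polynomial.rootMultiplicity_mul
    (mul_ne_zero (by simpa using hd) A.charpoly_monic.ne_zero), Polynomial.rootMultiplicity_C,
    zero_add] at h
  rw [h, Finset.sum_eq_single j]
  · rw [rootMultiplicity_of_simple_root_prod hf hb hb', if_pos rfl, mul_one]
  · intro i _ hij
    rw [rootMultiplicity_of_simple_root_prod hf hb hb', if_neg hij, mul_zero]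
  · simp

/-- When `∏ i, f i` is separable and annihilates `A`, a factorization of the characteristic polynomial
into powers of the `f i` determines `A` up to similarity. -/
theorem exists_sorted_diagonalization {s M : ℕ} {f : Fin s → ℂ[X]} (hf : ∀ i, f i ≠ 0)
    {A : Matrix (Fin M) (Fin M) ℂ} {α : Fin s → ℕ} {d : ℂ} (hd : d ≠ 0)
    (hchar : C d * A.charpoly = ∏ i, f i ^ α i) (hA : aeval A (∏ i, f i) = 0)
    (hs : (∏ i, f i).Separable) :
    ∃ (e : Fin M ≃ (Σ j : Fin s, {w : ℂ // (f j).eval w = 0} × Fin (α j)))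
      (X : (Matrix (Fin M) (Fin M) ℂ)ˣ),
      A = (X : Matrix (Fin M) (Fin M) ℂ) * Matrix.diagonal (fun i => ((e i).2.1 : ℂ)) *
        ((X⁻¹ : (Matrix (Fin M) (Fin M) ℂ)ˣ) : Matrix (Fin M) (Fin M) ℂ) := by
  have hA' := aeval_toLin_eq_zero hA
  have hroot : ∀ j (w : ℂ), (f j).eval w = 0 → (∏ i, f i).eval w = 0 := fun j w hw => by
    rw [eval_prod]; exact Finset.prod_eq_zero (Finset.mem_univ j) hw
  have hder : ∀ j (w : ℂ), (f j).eval w = 0 → (derivative (∏ i, f i)).eval w ≠ 0 :=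
    fun j w hw => hs.aeval_derivative_ne_zero (hroot j w hw)
  let μ : (Σ j : Fin s, {w : ℂ // (f j).eval w = 0}) → ℂ := fun i => i.2
  have hμ : Function.Injective μ := by
    rintro ⟨i, w, hw⟩ ⟨j, w', hw'⟩ (rfl : w = w')
    obtain rfl : i = j := by
      by_contra hij
      have h1 := rootMultiplicity_of_simple_root_prod hf hw' (hder j w hw') i
      rw [if_neg hij] at h1
      have := (Polynomial.rootMultiplicity_pos (hf i)).2 hw
      omega
    rfl
  have htop := iSup_eigenspace_eq_top_of_separable (μ := μ) hA' hs fun w hw => by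
    rw [eval_prod, Finset.prod_eq_zero_iff] at hw
    obtain ⟨j, -, hj⟩ := hw
    exact ⟨⟨j, w, hj⟩, rfl⟩
  obtain ⟨b, hb⟩ := exists_basis_of_eigenspaces (Matrix.toLin' A) hμ (n := fun i => α i.1)
    (fun i => finrank_eigenspace_of_charpoly hf hd hchar hA i.2.2 (hder i.1 _ i.2.2)) htop
  let g : (Σ i : (Σ j : Fin s, {w : ℂ // (f j).eval w = 0}), Fin (α i.1)) ≃
      (Σ j : Fin s, {w : ℂ // (f j).eval w = 0} × Fin (α j)) :=
    (Equiv.sigmaAssoc fun j (_ : {w : ℂ // (f j).eval w = 0}) => Fin (α j)).trans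
      (Equiv.sigmaCongrRight fun j => Equiv.sigmaEquivProd _ _)
  exact exists_diagonalization (μ := fun k : (Σ j : Fin s, {w : ℂ // (f j).eval w = 0} × Fin (α j))
    => (k.2.1 : ℂ)) (b.reindex g) fun k => by
      rw [Module.Basis.reindex_apply]
      exact hb (g.symm k)

section RationalSymbol

variable {M : ℕ} {Φ : ℂ → Matrix (Fin M) (Fin M) ℂ} {q : ℂ[X]} {P : Matrix (Fin M) (Fin M) ℂ[X]}

/-- The polynomial `det (q(X) Y - P(X))`, the characteristic polynomial of the matrix function
`P / q` with denominators cleared. -/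
noncomputable def bivariateCharpoly (q : ℂ[X]) (P : Matrix (Fin M) (Fin M) ℂ[X]) : ℂ[X][Y] :=
  ((C q * X : ℂ[X][Y]) • (1 : Matrix (Fin M) (Fin M) ℂ[X][Y]) - P.map C).det

theorem map_bivariateCharpoly {z : ℂ} {A : Matrix (Fin M) (Fin M) ℂ}
    (h : q.eval z • A = P.map (Polynomial.eval z)) :
    (bivariateCharpoly q P).map (evalRingHom z) = C (q.eval z ^ M) * A.charpoly := by
  rw [bivariateCharpoly, ← coe_mapRingHom, RingHom.map_det, Matrix.charpoly, C_pow]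
  have : (mapRingHom (evalRingHom z)).mapMatrix
      ((C q * X : ℂ[X][Y]) • (1 : Matrix (Fin M) (Fin M) ℂ[X][Y]) - P.map C) =
      (C (q.eval z) : ℂ[X]) • A.charmatrix := by
    ext1 i j
    have hij := congrFun (congrFun h i) j
    simp only [Matrix.smul_apply, Matrix.map_apply, smul_eq_mul] at hij
    simp only [RingHom.mapMatrix_apply, Matrix.map_apply, Matrix.sub_apply, Matrix.smul_apply,
      Matrix.charmatrix_apply, smul_eq_mul, coe_mapRingHom, Polynomial.map_sub, Polynomial.map_mul,
      Polynomial.map_C, Polynomial.map_X, coe_evalRingHom, ← hij, C_mul]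
    rw [Matrix.one_apply, Matrix.diagonal_apply]
    split_ifs <;> (simp; try ring)
  rw [this, Matrix.det_smul, Fintype.card_fin]

theorem continuousOn_matrixVal {D : Set ℂ} (hΦ : ∀ z ∈ D, q.eval z ≠ 0 ∧
    q.eval z • Φ z = P.map (Polynomial.eval z)) (F : ℂ[X][Y]) :
    ContinuousOn (fun z => matrixVal F z (Φ z)) D := by
  have hc : ContinuousOn Φ D := by
    have : ContinuousOn (fun z => (q.eval z)⁻¹ • P.map (Polynomial.eval z)) D := by
      refine ContinuousOn.smul (q.continuous.continuousOn.inv₀ fun z hz => (hΦ z hz).1) ?_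
      exact (continuous_matrix fun i j => (P i j).continuous).continuousOn
    refine this.congr fun z hz => ?_
    change _ = (q.eval z)⁻¹ • P.map (Polynomial.eval z)
    rw [← (hΦ z hz).2, smul_smul, inv_mul_cancel₀ (hΦ z hz).1, one_smul]
  induction F using Polynomial.induction_on' with
  | add p r hp hr =>
    refine (hp.add hr).congr fun z _ => ?_
    simp [matrixVal]
  | monomial n c =>
    simp only [matrixVal, Polynomial.map_monomial, aeval_monomial, coe_evalRingHom,
      Algebra.algebraMap_eq_smul_one, smul_mul_assoc, one_mul]
    exact c.continuous.continuousOn.smul (hc.pow n)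

/-- The symbol is continuous on the closed disk, so polynomial relations extend to the circle. -/
theorem matrixVal_eq_zero_of_norm_le_one (hΦ : ∀ z : ℂ, ‖z‖ ≤ 1 → q.eval z ≠ 0 ∧
    q.eval z • Φ z = P.map (Polynomial.eval z)) {F : ℂ[X][Y]}
    (hF : ∀ z : ℂ, ‖z‖ < 1 → matrixVal F z (Φ z) = 0) {z : ℂ} (hz : ‖z‖ ≤ 1) :
    matrixVal F z (Φ z) = 0 := by
  have hc := continuousOn_matrixVal (D := Metric.closedBall 0 1)
    (fun z hz => hΦ z (by simpa using hz)) F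
  have := Set.EqOn.of_subset_closure (s := Metric.ball (0 : ℂ) 1) (t := Metric.closedBall 0 1)
    (g := fun _ => 0) (fun z hz => hF z (by simpa using hz)) hc continuousOn_const
    Metric.ball_subset_closedBall (closure_ball (0 : ℂ) one_ne_zero).ge
  exact this (by simpa using hz)

end RationalSymbol

theorem eval_eq_zero_of_charpoly_eval {M : ℕ} {A : Matrix (Fin M) (Fin M) ℂ} {p : ℂ[X]}
    (hp : aeval A p = 0) {w : ℂ} (hw : A.charpoly.eval w = 0) : p.eval w = 0 := by
  have h : w ∈ spectrum ℂ A := Matrix.mem_spectrum_iff_isRoot_charpoly.2 hw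
  have h2 := spectrum.subset_polynomial_aeval A p ⟨w, h, rfl⟩
  rw [hp] at h2
  by_contra hne
  rw [spectrum.mem_iff, sub_zero] at h2
  exact h2 ((isUnit_iff_ne_zero.2 hne).map (algebraMap ℂ (Matrix (Fin M) (Fin M) ℂ)))

theorem separable_of_ncard {p : ℂ[X]} (hp : p ≠ 0)
    (h : {w : ℂ | p.eval w = 0}.ncard = p.natDegree) : p.Separable := by
  classical
  rw [← Polynomial.nodup_roots_iff_of_splits hp (IsAlgClosed.splits p),
    ← Multiset.toFinset_card_eq_card_iff_nodup]
  have h1 : {w : ℂ | p.eval w = 0} = ↑p.roots.toFinset := by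
    ext w; simp [hp]
  rw [h1, Set.ncard_coe_finset] at h
  exact le_antisymm (Multiset.toFinset_card_le _) (h ▸ Polynomial.card_roots' p)

/-- The structure theorem for a model `Φ` of a pure isopair, in terms of bivariate polynomials and
using only roots that are simple in the second variable. -/
theorem exists_exponents {H : Type*} [NormedAddCommGroup H] [InnerProductSpace ℂ H]
    [CompleteSpace H] {s : ℕ} {F : Fin s → ℂ[X][Y]} (hirr : ∀ j, Irreducible (F j))
    (hsq : Squarefree (∏ j, F j)) (hdeg : ∀ j, 0 < (F j).natDegree) {S T : H →L[ℂ] H}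
    (hann : bivariateOp (∏ j, F j) S T = 0)
    (hmin : ∀ Q : ℂ[X][Y], bivariateOp Q S T = 0 → ∏ j, F j ∣ Q)
    {M : ℕ} {Φ : ℂ → Matrix (Fin M) (Fin M) ℂ} (hΦ : IsModel S T Φ) :
    ∃ α : Fin s → ℕ, (∀ j, 0 < α j) ∧ M = ∑ j, α j * (F j).natDegree ∧
      (∀ (j : Fin s) (a b : ℂ), ‖a‖ < 1 → (F j).evalEval a b = 0 →
        (derivative (∏ i, F i)).evalEval a b ≠ 0 →
          Module.finrank ℂ (jointKer S T a b) = α j) ∧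
      (∃ d : ℂ[X], ∀ z : ℂ, ‖z‖ ≤ 1 → d.eval z ≠ 0 ∧
        ∀ w : ℂ, d.eval z * (w • (1 : Matrix (Fin M) (Fin M) ℂ) - Φ z).det =
          ∏ j, (F j).evalEval z w ^ α j) ∧
      ∀ a : ℂ, ‖a‖ ≤ 1 →
        {w : ℂ | (∏ j, F j).evalEval a w = 0}.ncard = ∑ j, (F j).natDegree →
        ∃ (e : Fin M ≃ (Σ j : Fin s, {w : ℂ // (F j).evalEval a w = 0} × Fin (α j)))
          (X : (Matrix (Fin M) (Fin M) ℂ)ˣ),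
          Φ a = (X : Matrix (Fin M) (Fin M) ℂ) *
            Matrix.diagonal (fun i => ((e i).2.1 : ℂ)) *
              ((X⁻¹ : (Matrix (Fin M) (Fin M) ℂ)ˣ) : Matrix (Fin M) (Fin M) ℂ) := by
  obtain ⟨⟨⟨q, P, hqP⟩, -⟩, U, hU⟩ := hΦ
  have hS : ∀ (x : H) (z : ℂ), ‖z‖ < 1 → hardyVal (U (S x)) z = z • hardyVal (U x) z :=
    fun x z hz => (hU x z hz).1
  have hT : ∀ (x : H) (z : ℂ), ‖z‖ < 1 → hardyVal (U (T x)) z = (Φ z).mulVec (hardyVal (U x) z) :=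
    fun x z hz => (hU x z hz).2
  have hzero : ∀ z : ℂ, ‖z‖ ≤ 1 → matrixVal (∏ j, F j) z (Φ z) = 0 := fun z hz =>
    matrixVal_eq_zero_of_norm_le_one hqP (fun z hz => matrixVal_eq_zero hS hT hann hz) hz
  set Q := bivariateCharpoly q P with hQdef
  have hQ : ∀ z : ℂ, ‖z‖ ≤ 1 → Q.map (evalRingHom z) = C (q.eval z ^ M) * (Φ z).charpoly :=
    fun z hz => map_bivariateCharpoly (hqP z hz).2
  have hqM : ∀ z : ℂ, ‖z‖ ≤ 1 → q.eval z ^ M ≠ 0 := fun z hz => pow_ne_zero _ (hqP z hz).1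
  have hQmap : ∀ z : ℂ, ‖z‖ ≤ 1 → Q.map (evalRingHom z) ≠ 0 := fun z hz => by
    rw [hQ z hz]
    exact mul_ne_zero (C_ne_zero.2 (hqM z hz)) (Φ z).charpoly_monic.ne_zero
  have hQ0 : Q ≠ 0 := fun h => hQmap 0 (by simp) (by rw [h, Polynomial.map_zero])
  obtain ⟨h, α, hfac⟩ := exists_factorization hirr hQ0 fun z w hz hw => by
    rw [← map_evalRingHom_eval, hQ z hz.le, eval_mul, eval_C] at hw
    have := eval_eq_zero_of_charpoly_eval (hzero z hz.le) ((mul_eq_zero.1 hw).resolve_left (hqM z hz.le))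
    rwa [map_evalRingHom_eval] at this
  have hQann : bivariateOp Q S T = 0 := bivariateOp_eq_zero hS hT fun z hz => by
    rw [matrixVal, hQ z hz.le, map_mul, Matrix.aeval_self_charpoly, mul_zero]
  have hh0 : h ≠ 0 := by
    rintro rfl
    rw [C_0, zero_mul] at hfac
    exact hQ0 hfac
  -- every `F j` divides `Q`, because `Q` annihilates `(S, T)` by Cayley–Hamilton
  have hα : ∀ j, 0 < α j := fun j => exponent_pos hirr hsq (hdeg j) hh0 (hfac ▸ hmin Q hQann)
  set f : ℂ → Fin s → ℂ[X] := fun z j => (F j).map (evalRingHom z) with hf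
  have hfacz : ∀ z : ℂ, ‖z‖ ≤ 1 →
      C (q.eval z ^ M) * (Φ z).charpoly = C (h.eval z) * ∏ j, f z j ^ α j := fun z hz => by
    rw [← hQ z hz, hfac]
    simp [hf, Polynomial.map_prod]
  have hne : ∀ z : ℂ, ‖z‖ ≤ 1 → C (h.eval z) * ∏ j, f z j ^ α j ≠ 0 := fun z hz => by
    rw [← hfacz z hz, ← hQ z hz]
    exact hQmap z hz
  have hhz : ∀ z : ℂ, ‖z‖ ≤ 1 → h.eval z ≠ 0 := fun z hz h0 => hne z hz (by rw [h0]; simp)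
  have hfz : ∀ z : ℂ, ‖z‖ ≤ 1 → ∀ j, f z j ≠ 0 := fun z hz j h0 =>
    (right_ne_zero_of_mul (hne z hz)) (Finset.prod_eq_zero (Finset.mem_univ j)
      (by rw [h0, zero_pow (hα j).ne']))
  have hMz : ∀ z : ℂ, ‖z‖ ≤ 1 → M = ∑ j, α j * (f z j).natDegree := fun z hz => by
    have h1 := congrArg Polynomial.natDegree (hfacz z hz)
    rw [Polynomial.natDegree_C_mul (hqM z hz), Polynomial.natDegree_C_mul (hhz z hz),
      Matrix.charpoly_natDegree_eq_dim, Fintype.card_fin,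
      Polynomial.natDegree_prod _ _ fun j _ => pow_ne_zero _ (hfz z hz j)] at h1
    simpa [Polynomial.natDegree_pow] using h1
  have hM : M = ∑ j, α j * (F j).natDegree := by
    have hl : (∏ j, (F j).leadingCoeff) ≠ 0 :=
      Finset.prod_ne_zero_iff.2 fun j _ => leadingCoeff_ne_zero.2 (hirr j).ne_zero
    obtain ⟨z, hz, hz'⟩ := (infinite_disk_diff (Polynomial.finite_setOfPred_isRoot hl)).nonempty
    have hz'' : ∀ j, (F j).leadingCoeff.eval z ≠ 0 := fun j h0 => hz' (by
      change eval z _ = 0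
      rw [eval_prod]; exact Finset.prod_eq_zero (Finset.mem_univ j) h0)
    rw [hMz z (le_of_lt hz)]
    exact Finset.sum_congr rfl fun j _ => by
      rw [hf, Polynomial.natDegree_map_of_leadingCoeff_ne_zero _ (hz'' j)]
  -- no degree drops anywhere on the closed disk, since the weighted sum of degrees is always `M`
  have hdegz : ∀ z : ℂ, ‖z‖ ≤ 1 → ∀ j, (f z j).natDegree = (F j).natDegree := fun z hz j => by
    have hle : ∀ i ∈ Finset.univ, α i * (f z i).natDegree ≤ α i * (F i).natDegree := fun i _ =>
      Nat.mul_le_mul_left _ Polynomial.natDegree_map_le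
    have := (Finset.sum_eq_sum_iff_of_le hle).1 ((hMz z hz).symm.trans hM) j (Finset.mem_univ j)
    exact Nat.eq_of_mul_eq_mul_left (hα j) this
  have hlead : ∀ z : ℂ, ‖z‖ ≤ 1 → ∀ j, (f z j).leadingCoeff = (F j).leadingCoeff.eval z :=
    fun z hz j => by
      rw [Polynomial.leadingCoeff, hdegz z hz j, hf, Polynomial.coeff_map]
      rfl
  set d : ℂ[X] := ∏ j, (F j).leadingCoeff ^ α j with hd
  -- comparison of leading coefficients in `Y`
  have hdz : ∀ z : ℂ, ‖z‖ ≤ 1 → q.eval z ^ M = h.eval z * d.eval z := fun z hz => by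
    have h1 := congrArg Polynomial.leadingCoeff (hfacz z hz)
    rw [leadingCoeff_mul, leadingCoeff_mul, leadingCoeff_C, leadingCoeff_C,
      (Φ z).charpoly_monic.leadingCoeff, mul_one, leadingCoeff_prod] at h1
    rw [h1, hd, eval_prod]
    simp only [leadingCoeff_pow, hlead z hz, eval_pow]
  have hd0 : ∀ z : ℂ, ‖z‖ ≤ 1 → d.eval z ≠ 0 := fun z hz h0 =>
    hqM z hz (by rw [hdz z hz, h0, mul_zero])
  have hchar : ∀ z : ℂ, ‖z‖ ≤ 1 → C (d.eval z) * (Φ z).charpoly = ∏ j, f z j ^ α j :=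
    fun z hz => by
      apply mul_left_cancel₀ (C_ne_zero.2 (hhz z hz))
      rw [← hfacz z hz, hdz z hz, C_mul, mul_assoc]
  have hprod : ∀ z, (∏ j, F j).map (evalRingHom z) = ∏ j, f z j := fun z => Polynomial.map_prod _ _ _
  have hA : ∀ z : ℂ, ‖z‖ ≤ 1 → aeval (Φ z) (∏ j, f z j) = 0 := fun z hz => by
    rw [← hprod]
    exact hzero z hz
  refine ⟨α, hα, hM, fun j a b ha hj hder => ?_, ⟨d, fun z hz => ⟨hd0 z hz, fun w => ?_⟩⟩,
    fun a ha hcard => ?_⟩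
  · rw [finrank_jointKer hS hT b ha]
    refine finrank_eigenspace_of_charpoly (hfz a ha.le) (hd0 a ha.le) (hchar a ha.le) (hA a ha.le)
      (by rwa [hf, map_evalRingHom_eval]) ?_
    rwa [← hprod, derivative_map, map_evalRingHom_eval]
  · have h1 := congrArg (Polynomial.eval w) (hchar z hz)
    rw [eval_mul, eval_C, Matrix.eval_charpoly] at h1
    have h2 : (∏ j, f z j ^ α j).eval w = ∏ j, (F j).evalEval z w ^ α j := by
      rw [eval_prod]
      simp only [eval_pow, hf, map_evalRingHom_eval]
    rw [← h2, ← h1, Matrix.scalar_apply, Matrix.smul_one_eq_diagonal]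
  · have hsep : (∏ j, f a j).Separable := by
      refine separable_of_ncard (Finset.prod_ne_zero_iff.2 fun j _ => hfz a ha j) ?_
      rw [Polynomial.natDegree_prod _ _ fun j _ => hfz a ha j]
      simp only [hdegz a ha]
      rw [← hcard, ← hprod]
      simp only [map_evalRingHom_eval]
    obtain ⟨e, X, hX⟩ := exists_sorted_diagonalization (hfz a ha) (hd0 a ha) (hchar a ha) (hA a ha) hsep
    refine ⟨e.trans (Equiv.sigmaCongrRight fun j => Equiv.prodCongr
      (Equiv.subtypeEquivRight fun w => by rw [hf, map_evalRingHom_eval]) (Equiv.refl _)), X, hX⟩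

/-! ### Interchanging the variables, and the structure theorem -/

/-- A polynomial in two variables as a polynomial in `w` with coefficients in `ℂ[z]`. -/
noncomputable def toBivariate : MvPolynomial (Fin 2) ℂ ≃ₐ[ℂ] ℂ[X][Y] :=
  (Polynomial.Bivariate.equivMvPolynomial ℂ).symm

theorem toBivariate_monomial (m : Fin 2 →₀ ℕ) (c : ℂ) :
    toBivariate (MvPolynomial.monomial m c) = monomial (m 1) (monomial (m 0) c) := by
  rw [MvPolynomial.monomial_eq, Finsupp.prod_fintype _ _ (fun _ => pow_zero _), Fin.prod_univ_two,
    toBivariate]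
  simp [← Polynomial.C_mul_X_pow_eq_monomial, mul_assoc]

theorem evalEval_toBivariate (p : MvPolynomial (Fin 2) ℂ) (z w : ℂ) :
    (toBivariate p).evalEval z w = polyVal p z w := by
  induction p using MvPolynomial.induction_on' with
  | monomial m c =>
    rw [toBivariate_monomial, polyVal, MvPolynomial.eval_monomial,
      Finsupp.prod_fintype _ _ (fun _ => pow_zero _), Fin.prod_univ_two]
    simp [← Polynomial.C_mul_X_pow_eq_monomial, evalEval_mul, evalEval_C, evalEval_pow, evalEval_X,
      mul_assoc]
  | add p q hp hq =>
    rw [map_add, evalEval_add, hp, hq, polyVal, polyVal, polyVal, map_add]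

theorem bivariateOp_toBivariate {H : Type*} [NormedAddCommGroup H] [InnerProductSpace ℂ H]
    (p : MvPolynomial (Fin 2) ℂ) (S T : H →L[ℂ] H) :
    bivariateOp (toBivariate p) S T = polyOp p S T := by
  conv_lhs => rw [p.as_sum]
  rw [bivariateOp, map_sum, eval₂_finsetSum, polyOp]
  refine Finset.sum_congr rfl fun m _ => ?_
  rw [toBivariate_monomial, eval₂_monomial]
  change aeval S (monomial (m 0) (p.coeff m)) * T ^ m 1 = _
  rw [aeval_monomial, Algebra.algebraMap_eq_smul_one, smul_mul_assoc, one_mul, smul_mul_assoc]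

theorem derivative_toBivariate (p : MvPolynomial (Fin 2) ℂ) :
    derivative (toBivariate p) = toBivariate (MvPolynomial.pderiv 1 p) := by
  have := Polynomial.Bivariate.pderiv_one_equivMvPolynomial (toBivariate p)
  rw [toBivariate, AlgEquiv.apply_symm_apply] at this
  rw [toBivariate, this, AlgEquiv.symm_apply_apply]

/-- Interchanging the two variables. -/
noncomputable def swapVars : MvPolynomial (Fin 2) ℂ ≃ₐ[ℂ] MvPolynomial (Fin 2) ℂ :=
  MvPolynomial.renameEquiv ℂ (Equiv.swap 0 1)

theorem swapVars_monomial (m : Fin 2 →₀ ℕ) (c : ℂ) :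
    toBivariate (swapVars (MvPolynomial.monomial m c)) = monomial (m 0) (monomial (m 1) c) := by
  rw [swapVars, MvPolynomial.renameEquiv_apply, MvPolynomial.rename_monomial, toBivariate_monomial,
    Finsupp.mapDomain_equiv_apply, Finsupp.mapDomain_equiv_apply]
  simp

theorem polyVal_swapVars (p : MvPolynomial (Fin 2) ℂ) (z w : ℂ) :
    polyVal (swapVars p) z w = polyVal p w z := by
  rw [polyVal, polyVal, swapVars, MvPolynomial.renameEquiv_apply, MvPolynomial.eval_rename]
  congr 2
  ext i
  fin_cases i <;> simp

theorem polyOp_swapVars {H : Type*} [NormedAddCommGroup H] [InnerProductSpace ℂ H]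
    {S T : H →L[ℂ] H} (hST : S * T = T * S) (p : MvPolynomial (Fin 2) ℂ) :
    polyOp (swapVars p) T S = polyOp p S T := by
  rw [← bivariateOp_toBivariate, ← bivariateOp_toBivariate]
  induction p using MvPolynomial.induction_on' with
  | monomial m c =>
    rw [swapVars_monomial, toBivariate_monomial, bivariateOp, bivariateOp, eval₂_monomial,
      eval₂_monomial]
    change aeval T (monomial (m 1) c) * S ^ m 0 = aeval S (monomial (m 0) c) * T ^ m 1
    have hc : Commute S T := hST
    rw [aeval_monomial, aeval_monomial, mul_assoc, mul_assoc, (hc.pow_pow (m 0) (m 1)).eq]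
  | add p q hp hq =>
    simp only [bivariateOp, map_add, eval₂_add] at *
    rw [hp, hq]

theorem pderiv_swapVars (p : MvPolynomial (Fin 2) ℂ) :
    MvPolynomial.pderiv 1 (swapVars p) = swapVars (MvPolynomial.pderiv 0 p) := by
  have := MvPolynomial.pderiv_rename (R := ℂ) (Equiv.swap (0 : Fin 2) 1).injective 0 p
  simpa [swapVars] using this

theorem degreeOf_swapVars (p : MvPolynomial (Fin 2) ℂ) :
    (swapVars p).degreeOf 1 = p.degreeOf 0 := by
  have := MvPolynomial.degreeOf_rename_of_injective (p := p) (Equiv.swap (0 : Fin 2) 1).injective 0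
  simpa [swapVars] using this

/-- Reduced to `MvPolynomial.finSuccEquiv`, which singles out the variable `0`, by interchanging the
variables. -/
theorem natDegree_toBivariate (p : MvPolynomial (Fin 2) ℂ) :
    (toBivariate p).natDegree = p.degreeOf 1 := by
  have h : ∀ r : MvPolynomial (Fin 2) ℂ, (toBivariate (swapVars r)) =
      (MvPolynomial.finSuccEquiv ℂ 1 r).map
        (MvPolynomial.uniqueAlgEquiv ℂ (Fin 1)).toAlgHom.toRingHom := by
    intro r
    have : (toBivariate.toAlgHom.comp swapVars.toAlgHom) =
        (Polynomial.mapAlgHom (MvPolynomial.uniqueAlgEquiv ℂ (Fin 1)).toAlgHom).comp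
          (MvPolynomial.finSuccEquiv ℂ 1).toAlgHom := by
      refine MvPolynomial.algHom_ext fun i => ?_
      fin_cases i
      · simp [toBivariate, swapVars, MvPolynomial.finSuccEquiv_X_zero]
      · have := MvPolynomial.finSuccEquiv_X_succ (R := ℂ) (j := (0 : Fin 1))
        simp at this
        simp [toBivariate, swapVars, this]
    exact DFunLike.congr_fun this r
  obtain ⟨r, rfl⟩ := swapVars.surjective p
  rw [h, Polynomial.natDegree_map_eq_of_injective (MvPolynomial.uniqueAlgEquiv ℂ (Fin 1)).injective,
    MvPolynomial.natDegree_finSuccEquiv, degreeOf_swapVars]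

theorem IsInnerToral.swapVars {p : MvPolynomial (Fin 2) ℂ} (hp : IsInnerToral p) :
    IsInnerToral (swapVars p) := by
  intro z w h
  rw [polyVal_swapVars] at h
  simpa only [and_comm] using hp w z h

theorem IsInnerToral.of_dvd {p q : MvPolynomial (Fin 2) ℂ} (hp : IsInnerToral p) (h : q ∣ p) :
    IsInnerToral q := by
  obtain ⟨r, rfl⟩ := h
  intro z w hq
  exact hp z w (by rw [polyVal, map_mul]; exact mul_eq_zero_of_left hq _)

/-- An irreducible polynomial in `z` alone vanishes on a vertical line, which is incompatible with
inner torality. -/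
theorem IsInnerToral.degreeOf_one_pos {p : MvPolynomial (Fin 2) ℂ} (hp : IsInnerToral p)
    (hirr : Irreducible p) : 0 < p.degreeOf 1 := by
  rw [← natDegree_toBivariate, Nat.pos_iff_ne_zero]
  intro h0
  obtain ⟨g, hg⟩ := Polynomial.natDegree_eq_zero.1 h0
  have hgu : ¬ IsUnit g := fun h =>
    hirr.not_isUnit ((MulEquiv.isUnit_map toBivariate).1 (hg ▸ h.map C))
  have hg0 : g ≠ 0 := by
    rintro rfl
    rw [C_0] at hg
    exact hirr.ne_zero (toBivariate.injective (by rw [← hg, map_zero]))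
  obtain ⟨c, hc⟩ := IsAlgClosed.exists_root g (by
    intro h
    exact hgu (Polynomial.isUnit_iff_degree_eq_zero.2 h))
  have hz : ∀ w, polyVal p c w = 0 := fun w => by
    rw [← evalEval_toBivariate, ← hg, evalEval_C]
    exact hc
  -- a whole vertical line `{c} × ℂ` of zeros meets both `𝔻 × 𝔻` and the exterior region
  have h1 := hp c 0 (hz 0)
  have h2 := hp c 2 (hz 2)
  simp only [norm_zero, Complex.norm_ofNat] at h1 h2
  norm_num at h1 h2
  linarith

theorem squarefree_toBivariate {p : MvPolynomial (Fin 2) ℂ} (h : Squarefree p) :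
    Squarefree (toBivariate p) := by
  intro x hx
  obtain ⟨y, rfl⟩ := toBivariate.surjective x
  rw [← map_mul, map_dvd_iff] at hx
  exact (h y hx).map toBivariate

theorem squarefree_swapVars {p : MvPolynomial (Fin 2) ℂ} (h : Squarefree p) :
    Squarefree (swapVars p) := by
  intro x hx
  obtain ⟨y, rfl⟩ := swapVars.surjective x
  rw [← map_mul, map_dvd_iff] at hx
  exact (h y hx).map swapVars

theorem toBivariate_dvd {p q : MvPolynomial (Fin 2) ℂ} (h : p ∣ q) :
    toBivariate p ∣ toBivariate q := by
  obtain ⟨r, rfl⟩ := h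
  exact ⟨toBivariate r, map_mul _ _ _⟩

theorem irreducible_toBivariate {p : MvPolynomial (Fin 2) ℂ} (h : Irreducible p) :
    Irreducible (toBivariate p) :=
  (MulEquiv.irreducible_iff toBivariate).2 h

theorem irreducible_swapVars {p : MvPolynomial (Fin 2) ℂ} (h : Irreducible p) :
    Irreducible (swapVars p) :=
  (MulEquiv.irreducible_iff swapVars).2 h

theorem toBivariate_prod {s : ℕ} (pf : Fin s → MvPolynomial (Fin 2) ℂ) :
    ∏ j, toBivariate (pf j) = toBivariate (∏ j, pf j) :=
  (map_prod _ _ _).symm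

theorem swapVars_prod {s : ℕ} (pf : Fin s → MvPolynomial (Fin 2) ℂ) :
    ∏ j, swapVars (pf j) = swapVars (∏ j, pf j) :=
  (map_prod _ _ _).symm

theorem not_dvd_pderiv_one {s : ℕ} {pf : Fin s → MvPolynomial (Fin 2) ℂ}
    (hsq : Squarefree (∏ j, pf j)) (htoral : IsInnerToral (∏ j, pf j))
    (hirr : ∀ j, Irreducible (pf j)) (j : Fin s) :
    ¬ pf j ∣ MvPolynomial.pderiv 1 (∏ i, pf i) := by
  have hdeg := (htoral.of_dvd (Finset.dvd_prod_of_mem pf (Finset.mem_univ j))).degreeOf_one_pos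
    (hirr j)
  have hsq' : Squarefree (∏ j, toBivariate (pf j)) := by
    rw [toBivariate_prod]; exact squarefree_toBivariate hsq
  have hdeg' : 0 < (toBivariate (pf j)).natDegree := by rwa [natDegree_toBivariate]
  have h := not_dvd_derivative_prod (fun i => irreducible_toBivariate (hirr i)) hsq' hdeg'
  rw [toBivariate_prod, derivative_toBivariate] at h
  exact fun h' => h (toBivariate_dvd h')

/-- Every component of the zero set has a point in the bidisk at which both partial derivatives
are nonzero. -/
theorem exists_generic_point {s : ℕ} {pf : Fin s → MvPolynomial (Fin 2) ℂ}
    (hsq : Squarefree (∏ j, pf j)) (htoral : IsInnerToral (∏ j, pf j))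
    (hirr : ∀ j, Irreducible (pf j)) (j : Fin s) :
    ∃ a b : ℂ, ‖a‖ < 1 ∧ ‖b‖ < 1 ∧ polyVal (pf j) a b = 0 ∧
      polyVal (MvPolynomial.pderiv 0 (∏ i, pf i)) a b ≠ 0 ∧
      polyVal (MvPolynomial.pderiv 1 (∏ i, pf i)) a b ≠ 0 := by
  have ht := htoral.of_dvd (Finset.dvd_prod_of_mem pf (Finset.mem_univ j))
  have h1 := not_dvd_pderiv_one hsq htoral hirr j
  have h0 : ¬ pf j ∣ MvPolynomial.pderiv 0 (∏ i, pf i) := by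
    have := not_dvd_pderiv_one (pf := fun i => swapVars (pf i))
      (by rw [swapVars_prod]; exact squarefree_swapVars hsq)
      (by rw [swapVars_prod]; exact htoral.swapVars)
      (fun i => irreducible_swapVars (hirr i)) j
    rw [swapVars_prod, pderiv_swapVars] at this
    exact fun h' => this (map_dvd swapVars h')
  have h : ¬ toBivariate (pf j) ∣ toBivariate (MvPolynomial.pderiv 0 (∏ i, pf i) *
      MvPolynomial.pderiv 1 (∏ i, pf i)) := by
    rw [map_dvd_iff]
    intro h
    rcases (hirr j).prime.dvd_or_dvd h with h | h
    exacts [h0 h, h1 h]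
  obtain ⟨a, b, ha, hab, hne⟩ := exists_zero_avoiding
    (irreducible_toBivariate (hirr j))
    (by rw [natDegree_toBivariate]; exact ht.degreeOf_one_pos (hirr j)) h
  rw [map_mul, evalEval_mul] at hne
  simp only [evalEval_toBivariate] at hab hne
  refine ⟨a, b, ha, ?_, hab, left_ne_zero_of_mul hne, right_ne_zero_of_mul hne⟩
  rcases ht a b hab with h | h | h
  · exact h.2
  · exact absurd h.1 ha.ne
  · exact absurd h.1 ha.not_gt

theorem IsPureIsopair.swap {H : Type*} [NormedAddCommGroup H] [InnerProductSpace ℂ H]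
    {p : MvPolynomial (Fin 2) ℂ} {S T : H →L[ℂ] H} (h : IsPureIsopair p S T) :
    IsPureIsopair (swapVars p) T S where
  pure_left := h.pure_right
  pure_right := h.pure_left
  comm := h.comm.symm
  annihilates := by rw [polyOp_swapVars h.comm, h.annihilates]
  minimal q hq := by
    obtain ⟨r, rfl⟩ := swapVars.surjective q
    rw [polyOp_swapVars h.comm] at hq
    exact map_dvd swapVars (h.minimal r hq)

/-- The structure theorem for a model `Φ`, with the fiber dimension computed only where the
derivative in the second variable is nonzero. -/
theorem IsPureIsopair.exists_exponents_of_isModel {H : Type*} [NormedAddCommGroup H]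
    [InnerProductSpace ℂ H] [CompleteSpace H] {s : ℕ} {pf : Fin s → MvPolynomial (Fin 2) ℂ}
    (hsq : Squarefree (∏ j, pf j)) (htoral : IsInnerToral (∏ j, pf j))
    (hirr : ∀ j, Irreducible (pf j)) {S T : H →L[ℂ] H} (hV : IsPureIsopair (∏ j, pf j) S T)
    {M : ℕ} {Φ : ℂ → Matrix (Fin M) (Fin M) ℂ} (hΦ : IsModel S T Φ) :
    ∃ α : Fin s → ℕ, (∀ j, 0 < α j) ∧ M = ∑ j, α j * (pf j).degreeOf 1 ∧
      (∀ (j : Fin s) (a b : ℂ), ‖a‖ < 1 → polyVal (pf j) a b = 0 →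
        polyVal (MvPolynomial.pderiv 1 (∏ i, pf i)) a b ≠ 0 →
          Module.finrank ℂ (jointKer S T a b) = α j) ∧
      (∃ d : ℂ[X], ∀ z : ℂ, ‖z‖ ≤ 1 → d.eval z ≠ 0 ∧
        ∀ w : ℂ, d.eval z * (w • (1 : Matrix (Fin M) (Fin M) ℂ) - Φ z).det =
          ∏ j, polyVal (pf j) z w ^ α j) ∧
      ∀ a : ℂ, ‖a‖ ≤ 1 →
        {w : ℂ | polyVal (∏ j, pf j) a w = 0}.ncard = ∑ j, (pf j).degreeOf 1 →
        ∃ (e : Fin M ≃ (Σ j : Fin s, {w : ℂ // polyVal (pf j) a w = 0} × Fin (α j)))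
          (X : (Matrix (Fin M) (Fin M) ℂ)ˣ),
          Φ a = (X : Matrix (Fin M) (Fin M) ℂ) *
            Matrix.diagonal (fun i => ((e i).2.1 : ℂ)) *
              ((X⁻¹ : (Matrix (Fin M) (Fin M) ℂ)ˣ) : Matrix (Fin M) (Fin M) ℂ) := by
  have hsq' : Squarefree (∏ j, toBivariate (pf j)) := by
    rw [toBivariate_prod]; exact squarefree_toBivariate hsq
  have hdeg' : ∀ j, 0 < (toBivariate (pf j)).natDegree := fun j => by
    rw [natDegree_toBivariate]
    exact (htoral.of_dvd (Finset.dvd_prod_of_mem pf (Finset.mem_univ j))).degreeOf_one_pos (hirr j)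
  have hann : bivariateOp (∏ j, toBivariate (pf j)) S T = 0 := by
    rw [toBivariate_prod, bivariateOp_toBivariate]
    exact hV.annihilates
  have hmin : ∀ Q : ℂ[X][Y], bivariateOp Q S T = 0 → ∏ j, toBivariate (pf j) ∣ Q := fun Q hQ => by
    obtain ⟨r, rfl⟩ := toBivariate.surjective Q
    rw [bivariateOp_toBivariate] at hQ
    rw [toBivariate_prod]
    exact toBivariate_dvd (hV.minimal r hQ)
  obtain ⟨α, h1, h2, h3, h4, h5⟩ := exists_exponents
    (fun j => irreducible_toBivariate (hirr j)) hsq' hdeg' hann hmin hΦ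
  simp only [toBivariate_prod, natDegree_toBivariate, derivative_toBivariate, evalEval_toBivariate]
    at h2 h3 h4
  refine ⟨α, h1, h2, h3, h4, fun a ha hcard => ?_⟩
  obtain ⟨e, X, hX⟩ := h5 a ha (by
    simp only [toBivariate_prod, natDegree_toBivariate, evalEval_toBivariate]
    exact hcard)
  exact ⟨e.trans (Equiv.sigmaCongrRight fun j => Equiv.prodCongr
    (Equiv.subtypeEquivRight fun w => by rw [evalEval_toBivariate]) (Equiv.refl _)), X, hX⟩

theorem theorem1p2 {H : Type*} [NormedAddCommGroup H] [InnerProductSpace ℂ H] [CompleteSpace H]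
    (s : ℕ) (p : MvPolynomial (Fin 2) ℂ) (pf : Fin s → MvPolynomial (Fin 2) ℂ)
    (hsq : Squarefree p) (htoral : IsInnerToral p)
    (hirr : ∀ j, Irreducible (pf j)) (hprod : p = ∏ j, pf j)
    (S T : H →L[ℂ] H) (hV : IsPureIsopair p S T)
    (M N : ℕ) (hM : HasMultiplicity S M) (hN : HasMultiplicity T N) :
    ∃ α : Fin s → ℕ, (∀ j, 0 < α j) ∧
      N = ∑ j, α j * (pf j).degreeOf 0 ∧
      M = ∑ j, α j * (pf j).degreeOf 1 ∧
      (∀ (j : Fin s) (a b : ℂ), ‖a‖ < 1 → ‖b‖ < 1 → polyVal (pf j) a b = 0 →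
        IsRegularPoint p a b → Module.finrank ℂ (jointKer S T a b) = α j) ∧
      (∃ Φ : ℂ → Matrix (Fin M) (Fin M) ℂ, IsModel S T Φ) ∧
      ∀ Φ : ℂ → Matrix (Fin M) (Fin M) ℂ, IsModel S T Φ →
        (∃ d : Polynomial ℂ, ∀ z : ℂ, ‖z‖ ≤ 1 → d.eval z ≠ 0 ∧
          ∀ w : ℂ, d.eval z * (w • (1 : Matrix (Fin M) (Fin M) ℂ) - Φ z).det =
            ∏ j, polyVal (pf j) z w ^ α j) ∧
        ∀ a : ℂ, ‖a‖ ≤ 1 →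
          {w : ℂ | polyVal p a w = 0}.ncard = ∑ j, (pf j).degreeOf 1 →
          ∃ (e : Fin M ≃ (Σ j : Fin s, {w : ℂ // polyVal (pf j) a w = 0} × Fin (α j)))
            (X : (Matrix (Fin M) (Fin M) ℂ)ˣ),
            Φ a = (X : Matrix (Fin M) (Fin M) ℂ) *
              Matrix.diagonal (fun i => ((e i).2.1 : ℂ)) *
                ((X⁻¹ : (Matrix (Fin M) (Fin M) ℂ)ˣ) : Matrix (Fin M) (Fin M) ℂ) := by
  subst hprod
  obtain ⟨Φ₀, hΦ₀⟩ := exists_isModel hV.pure_left hV.pure_right.1 hV.comm hM hN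
  obtain ⟨Ψ₀, hΨ₀⟩ := exists_isModel hV.pure_right hV.pure_left.1 hV.comm.symm hN hM
  obtain ⟨α, hα, hMα, hαker, -⟩ := hV.exists_exponents_of_isModel hsq htoral hirr hΦ₀
  have hV' := hV.swap
  rw [← swapVars_prod] at hV'
  obtain ⟨β, -, hNβ, hβker, -⟩ := hV'.exists_exponents_of_isModel
    (by rw [swapVars_prod]; exact squarefree_swapVars hsq)
    (by rw [swapVars_prod]; exact htoral.swapVars)
    (fun i => irreducible_swapVars (hirr i)) hΨ₀
  have hβker' : ∀ (j : Fin s) (a b : ℂ), ‖b‖ < 1 → polyVal (pf j) a b = 0 →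
      polyVal (MvPolynomial.pderiv 0 (∏ i, pf i)) a b ≠ 0 →
        Module.finrank ℂ (jointKer S T a b) = β j := by
    intro j a b hb hab hd
    have := hβker j b a hb (by rwa [polyVal_swapVars])
      (by rwa [swapVars_prod, pderiv_swapVars, polyVal_swapVars])
    rwa [jointKer, inf_comm] at this
  -- both exponents are the dimension of one joint eigenspace at a generic point
  have hβα : β = α := by
    funext j
    obtain ⟨a, b, ha, hb, hab, h0, h1⟩ := exists_generic_point hsq htoral hirr j
    rw [← hβker' j a b hb hab h0, hαker j a b ha hab h1]
  subst hβα
  refine ⟨β, hα, by simpa only [degreeOf_swapVars] using hNβ, hMα, ?_, ⟨Φ₀, hΦ₀⟩, fun Φ hΦ => ?_⟩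
  · rintro j a b ha hb hab ⟨-, h0 | h1⟩
    exacts [hβker' j a b hb hab h0, hαker j a b ha hab h1]
  · obtain ⟨γ, -, -, hγker, hγ⟩ := hV.exists_exponents_of_isModel hsq htoral hirr hΦ
    have hγβ : γ = β := by
      funext j
      obtain ⟨a, b, ha, -, hab, -, h1⟩ := exists_generic_point hsq htoral hirr j
      rw [← hγker j a b ha hab h1, hαker j a b ha hab h1]
    exact hγβ ▸ hγ
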